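/- Let $a_1,\dots,a_4,b_1,\dots,b_4,c_1,c_2,c_3,d_1,d_2,d_3$ be smooth functions on $[0,\infty)$. For a smooth Riemannian manifold $(M,g)$ of dimension $n\ge 1$, let $t=\frac12 g(y,y)$ be the energy density of $y\in TM$, let $X^H$ and $X^V$ be the horizontal lift (with respect to the Levi-Civita connection of $g$) and the vertical lift of $X$ to $TM$, and let $J$ and $G$ be the natural lifts of $g$ to $TM$ given at $y\in TM$ by $$JX^H=a_1(t)X^V+b_1(t)g(X,y)y^V+a_4(t)X^H+b_4(t)g(X,y)y^H,$$ $$JX^V=a_3(t)X^V+b_3(t)g(X,y)y^V-a_2(t)X^H-b_2(t)g(X,y)y^H,$$ $$G(X^H,Y^H)=c_1(t)g(X,Y)+d_1(t)g(X,y)g(Y,y),\qquad G(X^V,Y^V)=c_2(t)g(X,Y)+d_2(t)g(X,y)g(Y,y),$$ $$G(X^V,Y^H)=c_3(t)g(X,Y)+d_3(t)g(X,y)g(Y,y).$$ The pair $(G,J)$ is a general natural almost anti-Hermitian structure on $TM$ if, on all of $TM$, $J^2=-1$, $G$ is nondegenerate, and $G(JX,JY)=-G(X,Y)$. It is semi-anti-Kähler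 if moreover $\Phi=0$ on $TM$, where $\Phi(Z)=G^{AB}F(E_A,E_B,Z)$ for any local frame $(E_A)$ of $TM$, $(G^{AB})$ is the inverse of the matrix $(G(E_A,E_B))$, $F(X,Y,Z)=G((\nabla_XJ)Y,Z)$, and $\nabla$ is the Levi-Civita connection of $G$. Let $(M,g)$ be a nonempty smooth Riemannian manifold of dimension $n\ge1$ such that $(G,J)$ is a semi-anti-Kähler structure on $TM$. Then: (i) $M$ is Einstein, i.e. $\mathrm{Ric}=\rho g$ for some constant $\rho\in\mathbb R$. (ii) Suppose that the same coefficient functions also give a semi-anti-Kähler structure on the tangent bundle of some nonempty smooth Riemannian manifold of some dimension $m\ge 1$, $m\neq n$ (in particular, this holds when they give semi-anti-Kähler structures over base manifolds of every dimension). Then for every $t\ge 0$ with $a_1c_3(a_3+2b_3t)\ne c_1(1+a_3^2+2a_3b_3t)$ the derivative of $c_3$ at $t$ (one-sided at $t=0$) is $$c_3'=\frac{2a_1'(1+a_3^2)b_3c_1^2t-a_1^2c_3\{c_1'(1-a_3^2)-2a_3'b_3c_1t+a_3[a_3'c_1+a_1'c_3-2b_3(c_1+c_1't)]-a_1c_3(a_3'-b_3)\}}{a_1^2[a_1c_3(a_3+2b_3t)-c_1(1+a_3^2+2a_3b_3t)]}$$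 $$-\frac{c_1}{a_1}\cdot\frac{(1+a_3^2)(b_3c_1+a_3c_1'-a_1'c_3)+2b_3(c_1'+a_3(a_3'c_1+a_3c_1'+a_1'c_3))t}{a_1c_3(a_3+2b_3t)-c_1(1+a_3^2+2a_3b_3t)}.$$ -/

import Mathlib

open scoped Manifold ContDiff Matrix

noncomputable section

namespace NaturalLift

/-! ### Semi-Riemannian geometry in local coordinates

A coordinate domain is a subset of `ι → ℝ`, and a metric on it is given by its matrix of components
`h x i j`.  The same formulas are used for the base manifold (`ι = Fin n`) and for its tangent
bundle (`ι = Fin n ⊕ Fin n`). -/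

section Coordinates

variable {ι : Type} [Fintype ι] [DecidableEq ι]

/-- The partial derivative `∂f/∂x^i` at `x`. -/
def pderiv (i : ι) (f : (ι → ℝ) → ℝ) (x : ι → ℝ) : ℝ :=
  fderiv ℝ f x (Pi.single i 1)

/-- The Christoffel symbol `Γ^k_{ij}` of the Levi-Civita connection of the metric `h`. -/
def christoffel (h : (ι → ℝ) → Matrix ι ι ℝ) (k i j : ι) (x : ι → ℝ) : ℝ :=
  (1 / 2) * ∑ l, (h x)⁻¹ k l *
    (pderiv i (fun z => h z j l) x + pderiv j (fun z => h z i l) x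
      - pderiv l (fun z => h z i j) x)

/-- The component `R^k_{lij}` of the curvature tensor, `R(∂_i, ∂_j) ∂_l = R^k_{lij} ∂_k`, with
`R(X, Y) = ∇_X ∇_Y - ∇_Y ∇_X - ∇_[X,Y]`. -/
def curvature (h : (ι → ℝ) → Matrix ι ι ℝ) (k l i j : ι) (x : ι → ℝ) : ℝ :=
  pderiv i (christoffel h k j l) x - pderiv j (christoffel h k i l) x
    + ∑ m, (christoffel h k i m x * christoffel h m j l x
      - christoffel h k j m x * christoffel h m i l x)

/-- The component `Ric_{lj} = R^i_{lij}` of the Ricci tensor. -/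
def ricci (h : (ι → ℝ) → Matrix ι ι ℝ) (l j : ι) (x : ι → ℝ) : ℝ :=
  ∑ i, curvature h i l i j x

/-- The component `(∇_{∂_a} J)^d_b` of the covariant derivative of a `(1,1)`-tensor field `J`,
`J ∂_b = J^d_b ∂_d`, with respect to the Levi-Civita connection of the metric `G`. -/
def covDeriv (G J : (ι → ℝ) → Matrix ι ι ℝ) (a d b : ι) (p : ι → ℝ) : ℝ :=
  pderiv a (fun q => J q d b) p
    + ∑ e, (christoffel G d a e p * J p e b - christoffel G e a b p * J p d e)

/-- The component `F(∂_a, ∂_b, ∂_c)` of the tensor field `F(X, Y, Z) = G((∇_X J) Y, Z)`. -/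
def tensorF (G J : (ι → ℝ) → Matrix ι ι ℝ) (a b c : ι) (p : ι → ℝ) : ℝ :=
  ∑ d, covDeriv G J a d b p * G p d c

/-- The component `Φ(∂_c)` of the 1-form associated with `F`: the trace `G^{ab} F(E_a, E_b, ∂_c)`,
which does not depend on the frame `(E_a)`. -/
def formPhi (G J : (ι → ℝ) → Matrix ι ι ℝ) (c : ι) (p : ι → ℝ) : ℝ :=
  ∑ a, ∑ b, (G p)⁻¹ a b * tensorF G J a b c p

end Coordinates

/-! ### General natural lifts to the tangent bundle -/

/-- The coefficients of a natural lift: `a₁, …, a₄, b₁, …, b₄` for the endomorphism field `J`, and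
`c₁, c₂, c₃, d₁, d₂, d₃` for the metric `G`; all are functions of the energy density `t ≥ 0`
(their values at negative `t` are irrelevant). -/
structure Coefficients where
  (a₁ a₂ a₃ a₄ b₁ b₂ b₃ b₄ c₁ c₂ c₃ d₁ d₂ d₃ : ℝ → ℝ)

/-- All coefficients are smooth functions on `[0, ∞)`. -/
structure Coefficients.Smooth (κ : Coefficients) : Prop where
  a₁ : ContDiffOn ℝ ∞ κ.a₁ (Set.Ici 0)
  a₂ : ContDiffOn ℝ ∞ κ.a₂ (Set.Ici 0)
  a₃ : ContDiffOn ℝ ∞ κ.a₃ (Set.Ici 0)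
  a₄ : ContDiffOn ℝ ∞ κ.a₄ (Set.Ici 0)
  b₁ : ContDiffOn ℝ ∞ κ.b₁ (Set.Ici 0)
  b₂ : ContDiffOn ℝ ∞ κ.b₂ (Set.Ici 0)
  b₃ : ContDiffOn ℝ ∞ κ.b₃ (Set.Ici 0)
  b₄ : ContDiffOn ℝ ∞ κ.b₄ (Set.Ici 0)
  c₁ : ContDiffOn ℝ ∞ κ.c₁ (Set.Ici 0)
  c₂ : ContDiffOn ℝ ∞ κ.c₂ (Set.Ici 0)
  c₃ : ContDiffOn ℝ ∞ κ.c₃ (Set.Ici 0)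
  d₁ : ContDiffOn ℝ ∞ κ.d₁ (Set.Ici 0)
  d₂ : ContDiffOn ℝ ∞ κ.d₂ (Set.Ici 0)
  d₃ : ContDiffOn ℝ ∞ κ.d₃ (Set.Ici 0)

section Lift

variable {n : ℕ}

/-- Coordinates of a tangent vector in the induced chart: `Sum.elim x y`, where `x` are the
coordinates of the base point and `y` the components of the vector. -/
abbrev TangentCoord (n : ℕ) : Type := Fin n ⊕ Fin n → ℝ

/-- Coordinates of the base point. -/
def base (p : TangentCoord n) : Fin n → ℝ := fun i => p (Sum.inl i)

/-- Components of the tangent vector. -/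
def fibre (p : TangentCoord n) : Fin n → ℝ := fun i => p (Sum.inr i)

variable (h : (Fin n → ℝ) → Matrix (Fin n) (Fin n) ℝ)

/-- The energy density `t = (1/2) g_{ik} y^i y^k`. -/
def energy (p : TangentCoord n) : ℝ :=
  (1 / 2) * ∑ i, ∑ k, h (base p) i k * fibre p i * fibre p k

/-- `g_{0i} = y^k g_{ki}`. -/
def lowered (p : TangentCoord n) (i : Fin n) : ℝ :=
  ∑ k, fibre p k * h (base p) k i

/-- `Γ^k_{0i} = y^j Γ^k_{ji}`. -/
def connection (p : TangentCoord n) : Matrix (Fin n) (Fin n) ℝ :=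
  Matrix.of fun k i => ∑ j, fibre p j * christoffel h k j i (base p)

/-- The matrix whose columns are the adapted frame `δ_i = ∂/∂x^i - Γ^k_{0i} ∂/∂y^k` (the
horizontal lifts of `∂/∂x^i`) and `∂_i = ∂/∂y^i` (their vertical lifts), written in the natural
frame `(∂/∂x^i, ∂/∂y^i)` of the induced chart. -/
def adaptedFrame (p : TangentCoord n) : Matrix (Fin n ⊕ Fin n) (Fin n ⊕ Fin n) ℝ :=
  Matrix.fromBlocks 1 0 (-connection h p) 1

/-- The inverse of `adaptedFrame`. -/
def adaptedCoframe (p : TangentCoord n) : Matrix (Fin n ⊕ Fin n) (Fin n ⊕ Fin n) ℝ :=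
  Matrix.fromBlocks 1 0 (connection h p) 1

theorem adaptedFrame_mul_adaptedCoframe (p : TangentCoord n) :
    adaptedFrame h p * adaptedCoframe h p = 1 := by
  simp [adaptedFrame, adaptedCoframe, Matrix.fromBlocks_multiply]

/-- The endomorphism `X ↦ a(t) X + b(t) g(X, y) y`. -/
def endoBlock (a b : ℝ → ℝ) (p : TangentCoord n) : Matrix (Fin n) (Fin n) ℝ :=
  Matrix.of fun k i =>
    a (energy h p) * (1 : Matrix (Fin n) (Fin n) ℝ) k i
      + b (energy h p) * fibre p k * lowered h p i

/-- The bilinear form `(X, Y) ↦ c(t) g(X, Y) + d(t) g(X, y) g(Y, y)`. -/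
def formBlock (c d : ℝ → ℝ) (p : TangentCoord n) : Matrix (Fin n) (Fin n) ℝ :=
  Matrix.of fun i j =>
    c (energy h p) * h (base p) i j + d (energy h p) * lowered h p i * lowered h p j

/-- The general natural endomorphism field `J` in the natural frame of the induced chart:
`J X^H = a₁ X^V + b₁ g(X, y) y^V + a₄ X^H + b₄ g(X, y) y^H`,
`J X^V = a₃ X^V + b₃ g(X, y) y^V - a₂ X^H - b₂ g(X, y) y^H`. -/
def liftJ (κ : Coefficients) (p : TangentCoord n) : Matrix (Fin n ⊕ Fin n) (Fin n ⊕ Fin n) ℝ :=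
  adaptedFrame h p *
    Matrix.fromBlocks (endoBlock h κ.a₄ κ.b₄ p) (-endoBlock h κ.a₂ κ.b₂ p)
      (endoBlock h κ.a₁ κ.b₁ p) (endoBlock h κ.a₃ κ.b₃ p) *
    adaptedCoframe h p

/-- The general natural metric `G` in the natural frame of the induced chart:
`G(X^H, Y^H) = c₁ g(X, Y) + d₁ g(X, y) g(Y, y)`, and similarly `G(X^V, Y^V)` with `c₂, d₂` and
`G(X^V, Y^H)` with `c₃, d₃`. -/
def liftG (κ : Coefficients) (p : TangentCoord n) : Matrix (Fin n ⊕ Fin n) (Fin n ⊕ Fin n) ℝ :=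
  (adaptedCoframe h p)ᵀ *
    Matrix.fromBlocks (formBlock h κ.c₁ κ.d₁ p) (formBlock h κ.c₃ κ.d₃ p)
      (formBlock h κ.c₃ κ.d₃ p) (formBlock h κ.c₂ κ.d₂ p) *
    adaptedCoframe h p

end Lift

/-! ### Riemannian manifolds -/

section Manifold

variable {n : ℕ} {M : Type*} [TopologicalSpace M] [ChartedSpace (EuclideanSpace ℝ (Fin n)) M]
  [IsManifold (𝓡 n) ∞ M]

/-- Smooth Riemannian metrics on the `n`-dimensional manifold `M`. -/
abbrev Metric (n : ℕ) (M : Type*) [TopologicalSpace M]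
    [ChartedSpace (EuclideanSpace ℝ (Fin n)) M] [IsManifold (𝓡 n) ∞ M] :=
  Bundle.ContMDiffRiemannianMetric (𝓡 n) ∞ (EuclideanSpace ℝ (Fin n))
    (fun x : M => TangentSpace (𝓡 n) x)

/-- The components `g_{ij} = g(∂/∂x^i, ∂/∂x^j)` of `g` in the chart `e`, as functions of the
coordinates `x`; only the values at coordinates in the target of `e` are meaningful. -/
def components (g : Metric n M) (e : OpenPartialHomeomorph M (EuclideanSpace ℝ (Fin n)))
    (x : Fin n → ℝ) : Matrix (Fin n) (Fin n) ℝ :=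
  Matrix.of fun i j =>
    g.inner (e.symm (WithLp.toLp 2 x))
      (mfderiv (𝓡 n) (𝓡 n) e.symm (WithLp.toLp 2 x) (EuclideanSpace.single i (1 : ℝ)))
      (mfderiv (𝓡 n) (𝓡 n) e.symm (WithLp.toLp 2 x) (EuclideanSpace.single j (1 : ℝ)))

/-- `(M, g)` is Einstein: `Ric = ρ g` for a constant `ρ`. -/
def IsEinstein (g : Metric n M) : Prop :=
  ∃ ρ : ℝ, ∀ e ∈ IsManifold.maximalAtlas (𝓡 n) ∞ M, ∀ x : Fin n → ℝ, WithLp.toLp 2 x ∈ e.target →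
    ∀ i j, ricci (components g e) i j x = ρ * components g e x i j

/-- The natural lifts `J` and `G` of `g` with coefficients `κ` form an almost anti-Hermitian
structure on the whole tangent bundle of `M`: `J² = -1`, `G` is nondegenerate, and
`G(JX, JY) = -G(X, Y)`.  (Such a `G` automatically has signature `(n, n)`.) -/
def IsAlmostAntiHermitian (κ : Coefficients) (g : Metric n M) : Prop :=
  ∀ e ∈ IsManifold.maximalAtlas (𝓡 n) ∞ M, ∀ p : TangentCoord n, WithLp.toLp 2 (base p) ∈ e.target →
    liftJ (components g e) κ p * liftJ (components g e) κ p = -1 ∧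
    (liftG (components g e) κ p).det ≠ 0 ∧
    (liftJ (components g e) κ p)ᵀ * liftG (components g e) κ p * liftJ (components g e) κ p
      = -liftG (components g e) κ p

/-- The structure `(G, J)` on the tangent bundle of `M` is a general natural almost anti-Hermitian
structure which is semi-anti-Kähler: `Φ = 0` on the whole tangent bundle. -/
def IsSemiAntiKahler (κ : Coefficients) (g : Metric n M) : Prop :=
  IsAlmostAntiHermitian κ g ∧
  ∀ e ∈ IsManifold.maximalAtlas (𝓡 n) ∞ M, ∀ p : TangentCoord n, WithLp.toLp 2 (base p) ∈ e.target →
    ∀ c, formPhi (liftG (components g e) κ) (liftJ (components g e) κ) c p = 0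

end Manifold

/-- The derivative of a function on `[0, ∞)` (one-sided at `0`). -/
def deriv₀ (f : ℝ → ℝ) (t : ℝ) : ℝ := derivWithin f (Set.Ici 0) t

/-- The quantity `a₁ c₃ (a₃ + 2 b₃ t) - c₁ (1 + a₃² + 2 a₃ b₃ t)` at `t`. -/
def Coefficients.denom (κ : Coefficients) (t : ℝ) : ℝ :=
  κ.a₁ t * κ.c₃ t * (κ.a₃ t + 2 * κ.b₃ t * t)
    - κ.c₁ t * (1 + κ.a₃ t ^ 2 + 2 * κ.a₃ t * κ.b₃ t * t)

/-- The rational expression for `c₃'` at `t` in the other coefficients and their derivatives. -/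
def Coefficients.c₃Formula (κ : Coefficients) (t : ℝ) : ℝ :=
  let a₁ := κ.a₁ t
  let a₃ := κ.a₃ t
  let b₃ := κ.b₃ t
  let c₁ := κ.c₁ t
  let c₃ := κ.c₃ t
  let a₁' := deriv₀ κ.a₁ t
  let a₃' := deriv₀ κ.a₃ t
  let c₁' := deriv₀ κ.c₁ t
  (2 * a₁' * (1 + a₃ ^ 2) * b₃ * c₁ ^ 2 * t
      - a₁ ^ 2 * c₃ * (c₁' * (1 - a₃ ^ 2) - 2 * a₃' * b₃ * c₁ * t
          + a₃ * (a₃' * c₁ + a₁' * c₃ - 2 * b₃ * (c₁ + c₁' * t))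
          - a₁ * c₃ * (a₃' - b₃)))
      / (a₁ ^ 2 * κ.denom t)
    - c₁ / a₁ *
      (((1 + a₃ ^ 2) * (b₃ * c₁ + a₃ * c₁' - a₁' * c₃)
          + 2 * b₃ * (c₁' + a₃ * (a₃' * c₁ + a₃ * c₁' + a₁' * c₃)) * t)
        / κ.denom t)

end NaturalLift

end

/-! From J² = -1 and G(JX, JY) = -G(X, Y) it follows that J is G-symmetric, and hence so is every
∇_X J. Contracting F in its first two slots therefore gives the divergence of J: Φ(Z) is the trace
of X ↦ (∇_X J)Z. By the same symmetry the connection enters only through traces of the form tr(A G⁻¹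
∂G), so the Christoffel symbols of G never have to be computed (`formPhi_eq`). The formula is then
rewritten in the frame of horizontal and vertical lifts (`formPhi_frame`). Natural blocks are
parallel in horizontal directions, so their derivatives are commutators with the Christoffel
matrices of the base, and all these Christoffel terms cancel.

What remains of Φ on horizontal lifts (`formPhi_hor`) is a radial expression plus a curvature term.
The y ⊗ y♭ part of the latter dies by skew-symmetry of the curvature, and the rest is a Ricci
contraction (`sum_endoBlock_curvature`). Hence a₂(t) Ric(y, ·) is g(y, ·) times a number depending
only on t, n and the coefficients (`ricci_of_formPhi_eq_zero`). Fixing one t > 0 and letting y run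
over multiples of coordinate vectors gives Ric = ρ g with the same ρ at every point. No
connectedness and no Schur lemma are involved. For n = 1 the curvature is zero.

On vertical lifts (`scalar_of_formPhi_eq_zero`) Φ = 0 is a single scalar equation in t, affine in
the dimension. If it holds for two dimensions, its slope vanishes (`transverse_eq_zero`), and the
slope involves no d-coefficients. One of the two dimensions is at least 2, so a vector orthogonal to
y exists and yields a₄ = -a₃, a₁a₂ = 1 + a₃² and a₁c₂ = 2a₃c₃ - a₂c₁ (`coefficient_relations`).
Eliminating a₂, c₂ and c₂' leaves a linear equation for c₃' (`c₃_deriv_polynomial`). It is proved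
for t > 0 and reaches t = 0 by continuity. -/

set_option linter.unusedSectionVars false

noncomputable section

namespace NaturalLift

/-! ### Entrywise calculus of matrix-valued functions. -/

section MatrixDerivative

variable {ι l m k : Type} [Fintype ι] [Fintype m]

/-- Entrywise differentiability of a matrix-valued function. -/
def EntryDiff (A : (ι → ℝ) → Matrix l m ℝ) (p : ι → ℝ) : Prop :=
  ∀ a b, DifferentiableAt ℝ (fun q => A q a b) p

/-- The entrywise derivative of a matrix-valued function in the direction `v`. -/
def matDeriv (v : ι → ℝ) (A : (ι → ℝ) → Matrix l m ℝ) (p : ι → ℝ) : Matrix l m ℝ :=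
  Matrix.of fun a b => fderiv ℝ (fun q => A q a b) p v

theorem matDeriv_apply (v : ι → ℝ) (A : (ι → ℝ) → Matrix l m ℝ) (p : ι → ℝ) (a : l) (b : m) :
    matDeriv v A p a b = fderiv ℝ (fun q => A q a b) p v := rfl

theorem EntryDiff.mul {A : (ι → ℝ) → Matrix l m ℝ} {B : (ι → ℝ) → Matrix m k ℝ} {p : ι → ℝ}
    (hA : EntryDiff A p) (hB : EntryDiff B p) : EntryDiff (fun q => A q * B q) p := by
  intro a b
  simp only [Matrix.mul_apply]
  exact DifferentiableAt.fun_sum fun c _ => (hA a c).mul (hB c b)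

theorem matDeriv_mul {A : (ι → ℝ) → Matrix l m ℝ} {B : (ι → ℝ) → Matrix m k ℝ} {p : ι → ℝ}
    (hA : EntryDiff A p) (hB : EntryDiff B p) (v : ι → ℝ) :
    matDeriv v (fun q => A q * B q) p = matDeriv v A p * B p + A p * matDeriv v B p := by
  ext a b
  simp only [matDeriv_apply, Matrix.add_apply, Matrix.mul_apply]
  have hd : ∀ c ∈ Finset.univ, DifferentiableAt ℝ (fun q => A q a c * B q c b) p :=
    fun c _ => (hA a c).mul (hB c b)
  rw [fderiv_fun_sum hd, _root_.sum_apply, ← Finset.sum_add_distrib]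
  refine Finset.sum_congr rfl fun c _ => ?_
  rw [fderiv_fun_mul (hA a c) (hB c b)]
  simp
  ring

theorem EntryDiff.transpose {A : (ι → ℝ) → Matrix l m ℝ} {p : ι → ℝ} (hA : EntryDiff A p) :
    EntryDiff (fun q => (A q)ᵀ) p := fun a b => hA b a

theorem matDeriv_transpose (v : ι → ℝ) (A : (ι → ℝ) → Matrix l m ℝ) (p : ι → ℝ) :
    matDeriv v (fun q => (A q)ᵀ) p = (matDeriv v A p)ᵀ := rfl

theorem matDeriv_congr {A B : (ι → ℝ) → Matrix l m ℝ} {p : ι → ℝ} (h : A =ᶠ[nhds p] B)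
    (v : ι → ℝ) : matDeriv v A p = matDeriv v B p := by
  ext a b
  have : (fun q => A q a b) =ᶠ[nhds p] fun q => B q a b := h.mono fun q hq => by simp [hq]
  simp only [matDeriv_apply, this.fderiv_eq]

theorem matDeriv_eq_sum [DecidableEq ι] (v : ι → ℝ) (A : (ι → ℝ) → Matrix l m ℝ) (p : ι → ℝ) :
    matDeriv v A p = ∑ a, v a • matDeriv (Pi.single a 1) A p := by
  ext i j
  simp only [matDeriv_apply, Matrix.sum_apply, Matrix.smul_apply]
  conv_lhs => rw [pi_eq_sum_univ' v]
  rw [map_sum]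
  refine Finset.sum_congr rfl fun a _ => ?_
  rw [map_smul]

end MatrixDerivative

/-! ### Levi-Civita traces and Φ as a divergence, in coordinates and in a moving frame. -/

section Coordinates

variable {ι : Type} [Fintype ι] [DecidableEq ι]

/-- The connection matrix `(Γ_i)^k_l = Γ^k_{il}`. -/
def christoffelMatrix (h : (ι → ℝ) → Matrix ι ι ℝ) (i : ι) (x : ι → ℝ) : Matrix ι ι ℝ :=
  Matrix.of fun k l => christoffel h k i l x

theorem pderiv_symm {h : (ι → ℝ) → Matrix ι ι ℝ} {x : ι → ℝ}
    (hs : ∀ᶠ z in nhds x, (h z)ᵀ = h z) (i j l : ι) :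
    pderiv i (fun z => h z j l) x = pderiv i (fun z => h z l j) x := by
  have : (fun z => h z j l) =ᶠ[nhds x] fun z => h z l j :=
    hs.mono fun z hz => congrFun (congrFun hz.symm j) l
  rw [pderiv, this.fderiv_eq, pderiv]

theorem christoffel_comm {h : (ι → ℝ) → Matrix ι ι ℝ} {x : ι → ℝ}
    (hs : ∀ᶠ z in nhds x, (h z)ᵀ = h z) (k i j : ι) :
    christoffel h k i j x = christoffel h k j i x := by
  unfold christoffel
  congr 1
  refine Finset.sum_congr rfl fun l _ => ?_
  rw [pderiv_symm hs l i j]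
  ring

/-- The Christoffel symbols of the first kind. -/
theorem mul_christoffelMatrix_apply {h : (ι → ℝ) → Matrix ι ι ℝ} {x : ι → ℝ}
    (hdet : IsUnit (h x).det) (i l j : ι) :
    (h x * christoffelMatrix h i x) l j = (1 / 2) * (pderiv i (fun z => h z j l) x
      + pderiv j (fun z => h z i l) x - pderiv l (fun z => h z i j) x) := by
  have key : christoffelMatrix h i x = (h x)⁻¹ * Matrix.of fun l j =>
      (1 / 2) * (pderiv i (fun z => h z j l) x
        + pderiv j (fun z => h z i l) x - pderiv l (fun z => h z i j) x) := by
    ext k j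
    simp only [christoffelMatrix, christoffel, Matrix.of_apply, Matrix.mul_apply, Finset.mul_sum]
    exact Finset.sum_congr rfl fun l _ => by ring
  rw [key, Matrix.mul_nonsing_inv_cancel_left _ _ hdet, Matrix.of_apply]

/-- The Levi-Civita connection is metric. -/
theorem matDeriv_metric {h : (ι → ℝ) → Matrix ι ι ℝ} {x : ι → ℝ}
    (hs : ∀ᶠ z in nhds x, (h z)ᵀ = h z) (hdet : IsUnit (h x).det) (i : ι) :
    matDeriv (Pi.single i 1) h x
      = h x * christoffelMatrix h i x + (christoffelMatrix h i x)ᵀ * h x := by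
  have hsx : (h x)ᵀ = h x := hs.self_of_nhds
  have e : (christoffelMatrix h i x)ᵀ * h x = (h x * christoffelMatrix h i x)ᵀ := by
    rw [Matrix.transpose_mul, hsx]
  rw [e]
  ext a b
  rw [Matrix.add_apply, Matrix.transpose_apply, mul_christoffelMatrix_apply hdet,
    mul_christoffelMatrix_apply hdet, pderiv_symm hs i b a]
  change pderiv i (fun z => h z a b) x = _
  ring

/-- Against an H-symmetric A, a matrix B and its H-adjoint H⁻¹BᵀH have the same trace. This serves
whenever a derivative of a metric has the form HB + BᵀH, be it through the Christoffel matrices or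
through a moving coframe. -/
theorem trace_mul_inv_mul {H A : Matrix ι ι ℝ} (hdet : IsUnit H.det) (hA : H * A = Aᵀ * H)
    (B : Matrix ι ι ℝ) : (A * H⁻¹ * (H * B + Bᵀ * H)).trace = 2 * (A * B).trace := by
  have h1 : A * H⁻¹ * (H * B) = A * B := by
    rw [Matrix.mul_assoc, Matrix.nonsing_inv_mul_cancel_left _ _ hdet]
  have h2 : (A * H⁻¹ * (Bᵀ * H)).trace = (A * B).trace := by
    rw [← Matrix.mul_assoc, Matrix.trace_mul_comm, ← Matrix.mul_assoc, ← Matrix.mul_assoc, hA,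
      Matrix.mul_nonsing_inv_cancel_right _ _ hdet, ← Matrix.transpose_mul, Matrix.trace_transpose,
      Matrix.trace_mul_comm]
  rw [Matrix.mul_add, Matrix.trace_add, h1, h2]
  ring

/-- Metric compatibility expresses ∂_i h as hΓ_i + Γ_iᵀh, and a symmetric A does not distinguish the
two summands. -/
theorem trace_mul_christoffelMatrix {h : (ι → ℝ) → Matrix ι ι ℝ} {x : ι → ℝ}
    (hs : ∀ᶠ z in nhds x, (h z)ᵀ = h z) (hdet : IsUnit (h x).det)
    {A : Matrix ι ι ℝ} (hA : h x * A = Aᵀ * h x) (i : ι) :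
    (A * christoffelMatrix h i x).trace
      = (1 / 2) * (A * (h x)⁻¹ * matDeriv (Pi.single i 1) h x).trace := by
  rw [matDeriv_metric hs hdet, trace_mul_inv_mul hdet hA]
  ring

/-- The trace of the Levi-Civita connection. -/
theorem sum_christoffel {h : (ι → ℝ) → Matrix ι ι ℝ} {x : ι → ℝ}
    (hs : ∀ᶠ z in nhds x, (h z)ᵀ = h z) (hdet : IsUnit (h x).det) (i : ι) :
    ∑ a, christoffel h a a i x
      = (1 / 2) * ((h x)⁻¹ * matDeriv (Pi.single i 1) h x).trace := by
  have := trace_mul_christoffelMatrix hs hdet (A := 1) (by simp) i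
  rw [Matrix.one_mul, Matrix.one_mul] at this
  rw [← this, Matrix.trace]
  exact Finset.sum_congr rfl fun a _ => christoffel_comm hs a a i

/-- For a `G`-symmetric `J`, the 1-form `Φ` is the divergence of `J`. -/
theorem formPhi_eq {G J : (ι → ℝ) → Matrix ι ι ℝ} {p : ι → ℝ}
    (hs : ∀ᶠ z in nhds p, (G z)ᵀ = G z) (hdet : IsUnit (G p).det)
    (hJ : ∀ᶠ z in nhds p, G z * J z = (J z)ᵀ * G z)
    (dG : EntryDiff G p) (dJ : EntryDiff J p) (c : ι) :
    formPhi G J c p = ∑ a, matDeriv (Pi.single a 1) J p a c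
      + ∑ a, (1 / 2) * ((G p)⁻¹ * matDeriv (Pi.single a 1) G p).trace * J p a c
      - (1 / 2) * (J p * (G p)⁻¹ * matDeriv (Pi.single c 1) G p).trace := by
  have hJp : G p * J p = (J p)ᵀ * G p := hJ.self_of_nhds
  set D : ι → Matrix ι ι ℝ := fun a => matDeriv (Pi.single a 1) J p
      + christoffelMatrix G a p * J p - J p * christoffelMatrix G a p with hD
  have hcov : ∀ a d b, covDeriv G J a d b p = D a d b := by
    intro a d b
    simp only [covDeriv, hD, Matrix.add_apply, Matrix.sub_apply, Matrix.mul_apply,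
      Finset.sum_sub_distrib]
    rw [add_sub_assoc]
    congr 2
    exact Finset.sum_congr rfl fun e _ => mul_comm _ _
  -- Differentiating GJ = JᵀG and inserting metric compatibility shows that ∇_a J is again
  -- G-symmetric.
  have hsymm : ∀ a, (D a)ᵀ * G p = G p * D a := by
    intro a
    have h1 : matDeriv (Pi.single a 1) (fun q => G q * J q) p
        = matDeriv (Pi.single a 1) (fun q => (J q)ᵀ * G q) p := matDeriv_congr hJ _
    rw [matDeriv_mul dG dJ, matDeriv_mul dJ.transpose dG, matDeriv_transpose,
      matDeriv_metric hs hdet] at h1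
    simp only [hD]
    generalize matDeriv (Pi.single a 1) J p = J' at h1 ⊢
    simp only [Matrix.transpose_add, Matrix.transpose_sub, Matrix.transpose_mul]
    generalize christoffelMatrix G a p = Γ at h1 ⊢
    have h2 : (J p)ᵀ * (G p * Γ) = G p * J p * Γ := by rw [hJp, Matrix.mul_assoc]
    have h3 : Γᵀ * G p * J p = Γᵀ * ((J p)ᵀ * G p) := by rw [← hJp, Matrix.mul_assoc]
    have h4 : J'ᵀ * G p = G p * J' + (G p * Γ + Γᵀ * G p) * J p
        - (J p)ᵀ * (G p * Γ + Γᵀ * G p) := by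
      rw [eq_sub_iff_add_eq, ← h1, add_comm]
    simp only [Matrix.add_mul, Matrix.sub_mul, Matrix.mul_add, Matrix.mul_sub] at h4 ⊢
    rw [h4, h2, h3]
    simp only [Matrix.mul_assoc]
    abel
  have hF : ∀ a b, tensorF G J a b c p = (G p * D a) b c := by
    intro a b
    rw [← hsymm, Matrix.mul_apply]
    exact Finset.sum_congr rfl fun d _ => by rw [hcov, Matrix.transpose_apply]
  have h1 : formPhi G J c p = ∑ a, D a a c := by
    unfold formPhi
    -- By the symmetry just used, lowering an index with G and contracting with G⁻¹ cancel, so a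
    -- plain trace of ∇J is left.
    refine Finset.sum_congr rfl fun a _ => ?_
    rw [← Matrix.nonsing_inv_mul_cancel_left _ (D a) hdet, Matrix.mul_apply]
    exact Finset.sum_congr rfl fun b _ => by rw [hF]
  rw [h1]
  simp only [hD, Matrix.add_apply, Matrix.sub_apply, Finset.sum_sub_distrib, Finset.sum_add_distrib]
  congr 2
  · simp only [Matrix.mul_apply]
    rw [Finset.sum_comm]
    refine Finset.sum_congr rfl fun e _ => ?_
    rw [← sum_christoffel hs hdet, Finset.sum_mul]
    rfl
  · rw [← trace_mul_christoffelMatrix hs hdet hJp, Matrix.trace]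
    refine Finset.sum_congr rfl fun a _ => ?_
    simp only [Matrix.diag_apply, Matrix.mul_apply]
    exact Finset.sum_congr rfl fun e _ => by
      simp only [christoffelMatrix, Matrix.of_apply]; rw [christoffel_comm hs]

/-- The divergence formula of `formPhi_eq` in a moving frame: `S` is the matrix of the frame, `T` of
the dual coframe, `K` and `H` the components of `J` and `G`. -/
theorem formPhi_frame {G J S T K H : (ι → ℝ) → Matrix ι ι ℝ} {p : ι → ℝ}
    (hs : ∀ᶠ z in nhds p, (G z)ᵀ = G z) (hdet : IsUnit (G p).det)
    (hJ : ∀ᶠ z in nhds p, G z * J z = (J z)ᵀ * G z)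
    (dS : EntryDiff S p) (dT : EntryDiff T p) (dK : EntryDiff K p) (dH : EntryDiff H p)
    (hST : S p * T p = 1) (hJe : J = fun q => S q * K q * T q)
    (hGe : G = fun q => (T q)ᵀ * H q * T q) (β : ι) :
    ∑ c, formPhi G J c p * S p c β
      = ∑ α, (∑ a, matDeriv (Pi.single a 1) S p a α) * K p α β
        + ∑ α, matDeriv (fun a => S p a α) K p α β
        + ∑ α, (K p * (matDeriv (fun a => S p a α) T p * S p)) α β
        + ∑ α, ((1 / 2) * ((H p)⁻¹ * matDeriv (fun a => S p a α) H p).trace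
          + (matDeriv (fun a => S p a α) T p * S p).trace) * K p α β
        - (1 / 2) * (K p * (H p)⁻¹ * matDeriv (fun a => S p a β) H p).trace
        - (K p * (matDeriv (fun a => S p a β) T p * S p)).trace := by
  have hTS : T p * S p = 1 := mul_eq_one_comm.mp hST
  have hGp : G p = (T p)ᵀ * H p * T p := by rw [hGe]
  have hJp : J p = S p * K p * T p := by rw [hJe]
  have hTSt : (S p)ᵀ * (T p)ᵀ = 1 := by rw [← Matrix.transpose_mul, hTS, Matrix.transpose_one]
  have hSTt : (T p)ᵀ * (S p)ᵀ = 1 := by rw [← Matrix.transpose_mul, hST, Matrix.transpose_one]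
  have hHp : H p = (S p)ᵀ * G p * S p := by
    rw [hGp]
    simp only [Matrix.mul_assoc, hTS, Matrix.mul_one]
    rw [← Matrix.mul_assoc, hTSt, Matrix.one_mul]
  have hHdet : IsUnit (H p).det := by
    have hS : IsUnit (S p).det := Matrix.isUnit_det_of_right_inverse hST
    rw [hHp, Matrix.det_mul, Matrix.det_mul, Matrix.det_transpose]
    exact (hS.mul hdet).mul hS
  have hHK : H p * K p = (K p)ᵀ * H p := by
    have h1 : K p = T p * J p * S p := by
      rw [hJp]
      simp only [Matrix.mul_assoc, hTS, Matrix.mul_one]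
      rw [← Matrix.mul_assoc, hTS, Matrix.one_mul]
    have h2 : H p * K p = (S p)ᵀ * (G p * J p) * S p := by
      rw [hHp, h1]
      simp only [Matrix.mul_assoc]
      rw [← Matrix.mul_assoc (S p) (T p), hST, Matrix.one_mul]
    have h3 : (K p)ᵀ * H p = (S p)ᵀ * ((J p)ᵀ * G p) * S p := by
      rw [hHp, h1]
      simp only [Matrix.mul_assoc, Matrix.transpose_mul]
      rw [← Matrix.mul_assoc (T p)ᵀ (S p)ᵀ, hSTt, Matrix.one_mul]
    rw [h2, h3, hJ.self_of_nhds]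
  have hGinv : (G p)⁻¹ = S p * (H p)⁻¹ * (S p)ᵀ := by
    refine Matrix.inv_eq_right_inv ?_
    rw [hGp]
    simp only [Matrix.mul_assoc]
    rw [← Matrix.mul_assoc (T p) (S p), hTS, Matrix.one_mul, ← Matrix.mul_assoc (H p),
      Matrix.mul_nonsing_inv _ hHdet, Matrix.one_mul, hSTt]
  have dJ : EntryDiff J p := by rw [hJe]; exact (dS.mul dK).mul dT
  have dG : EntryDiff G p := by rw [hGe]; exact (dT.transpose.mul dH).mul dT
  have DJ : ∀ v, matDeriv v J p * S p = matDeriv v S p * K p + S p * matDeriv v K p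
      + S p * (K p * (matDeriv v T p * S p)) := by
    intro v
    rw [hJe, matDeriv_mul (dS.mul dK) dT, matDeriv_mul dS dK]
    simp only [Matrix.add_mul, Matrix.mul_assoc, hTS, Matrix.mul_one]
  have DG : ∀ v, (S p)ᵀ * matDeriv v G p * S p = (matDeriv v T p * S p)ᵀ * H p + matDeriv v H p
      + H p * (matDeriv v T p * S p) := by
    intro v
    rw [hGe, matDeriv_mul (dT.transpose.mul dH) dT, matDeriv_mul dT.transpose dH,
      matDeriv_transpose]
    simp only [Matrix.add_mul, Matrix.mul_add, Matrix.mul_assoc, hTS, Matrix.mul_one,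
      Matrix.transpose_mul]
    simp only [← Matrix.mul_assoc, hTSt, Matrix.one_mul]
  -- Needed twice: A = 1 gives the volume term, A = K the term twisted by J.
  have tr_eq : ∀ A : Matrix ι ι ℝ, H p * A = Aᵀ * H p → ∀ v,
      (S p * A * T p * (G p)⁻¹ * matDeriv v G p).trace
        = (A * (H p)⁻¹ * matDeriv v H p).trace + 2 * (A * (matDeriv v T p * S p)).trace := by
    intro A hA v
    have h1 : (S p * A * T p * (G p)⁻¹ * matDeriv v G p).trace
        = (A * (H p)⁻¹ * ((S p)ᵀ * matDeriv v G p * S p)).trace := by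
      rw [hGinv]
      have : S p * A * T p * (S p * (H p)⁻¹ * (S p)ᵀ) * matDeriv v G p
          = S p * (A * (H p)⁻¹ * ((S p)ᵀ * matDeriv v G p)) := by
        simp only [Matrix.mul_assoc]
        rw [← Matrix.mul_assoc (T p) (S p), hTS, Matrix.one_mul]
      rw [this, Matrix.trace_mul_comm]
      simp only [Matrix.mul_assoc]
    have h2 := trace_mul_inv_mul hHdet hA (matDeriv v T p * S p)
    rw [h1, DG, ← h2]
    simp only [Matrix.mul_add, Matrix.trace_add]
    ring
  -- Directional derivatives are linear in the direction, so contracting coordinate derivatives with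
  -- a frame column gives the derivative along that frame vector.
  have comb : ∀ (f : (ι → ℝ) → ℝ) (_ : ∀ v, f v = ∑ a, v a * f (Pi.single a 1)) (α : ι),
      ∑ a, f (Pi.single a 1) * S p a α = f fun a => S p a α := by
    intro f hf α
    rw [hf fun a => S p a α]
    exact Finset.sum_congr rfl fun a _ => mul_comm _ _
  have trG : ∀ (A : Matrix ι ι ℝ) α, ∑ c, (A * matDeriv (Pi.single c 1) G p).trace * S p c α
      = (A * matDeriv (fun a => S p a α) G p).trace := by
    intro A α
    refine comb (fun v => (A * matDeriv v G p).trace) (fun v => ?_) α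
    rw [matDeriv_eq_sum v]
    simp [Matrix.mul_sum, Matrix.trace_sum]
  have e1 : ∑ c, (∑ a, matDeriv (Pi.single a 1) J p a c) * S p c β
      = ∑ α, (∑ a, matDeriv (Pi.single a 1) S p a α) * K p α β
        + ∑ α, matDeriv (fun a => S p a α) K p α β
        + ∑ α, (K p * (matDeriv (fun a => S p a α) T p * S p)) α β := by
    have : ∑ c, (∑ a, matDeriv (Pi.single a 1) J p a c) * S p c β
        = ∑ a, (matDeriv (Pi.single a 1) J p * S p) a β := by
      simp only [Finset.sum_mul, Matrix.mul_apply]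
      exact Finset.sum_comm
    rw [this]
    simp only [DJ, Matrix.add_apply, Finset.sum_add_distrib]
    refine congrArg₂ (· + ·) (congrArg₂ (· + ·) ?_ ?_) ?_
    · simp only [Finset.sum_mul, Matrix.mul_apply]
      exact Finset.sum_comm
    · simp only [Matrix.mul_apply]
      rw [Finset.sum_comm]
      refine Finset.sum_congr rfl fun α _ => ?_
      rw [matDeriv_eq_sum (fun a => S p a α)]
      simp [Matrix.sum_apply]
    · rw [Finset.sum_congr rfl fun a (_ : a ∈ Finset.univ) => Matrix.mul_apply (i := a) (k := β)
        (M := S p), Finset.sum_comm]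
      refine Finset.sum_congr rfl fun α _ => ?_
      rw [matDeriv_eq_sum (fun a => S p a α)]
      simp [Matrix.sum_apply, Matrix.sum_mul, Matrix.mul_sum]
  have e2 : ∑ c, (∑ a, (1 / 2) * ((G p)⁻¹ * matDeriv (Pi.single a 1) G p).trace * J p a c) * S p c β
      = ∑ α, ((1 / 2) * ((H p)⁻¹ * matDeriv (fun a => S p a α) H p).trace
          + (matDeriv (fun a => S p a α) T p * S p).trace) * K p α β := by
    have h1 : ∀ v, ((G p)⁻¹ * matDeriv v G p).trace
        = ((H p)⁻¹ * matDeriv v H p).trace + 2 * (matDeriv v T p * S p).trace := by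
      intro v
      have := tr_eq 1 (by simp) v
      simpa [hST] using this
    have h2 : ∀ a, ∑ c, J p a c * S p c β = ∑ α, S p a α * K p α β := by
      intro a
      rw [← Matrix.mul_apply, ← Matrix.mul_apply, hJp, Matrix.mul_assoc, hTS, Matrix.mul_one]
    have h3 : ∀ α, (1 / 2) * ((H p)⁻¹ * matDeriv (fun a => S p a α) H p).trace
          + (matDeriv (fun a => S p a α) T p * S p).trace
        = ∑ a, (1 / 2) * ((G p)⁻¹ * matDeriv (Pi.single a 1) G p).trace * S p a α := by
      intro α
      simp only [mul_assoc, ← Finset.mul_sum]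
      rw [trG, h1]
      ring
    have h4 : ∀ u : ι → ℝ, ∑ c, (∑ a, u a * J p a c) * S p c β
        = ∑ α, (∑ a, u a * S p a α) * K p α β := by
      intro u
      simp only [Finset.sum_mul]
      rw [Finset.sum_comm]
      conv_rhs => rw [Finset.sum_comm]
      refine Finset.sum_congr rfl fun a _ => ?_
      simp only [mul_assoc, ← Finset.mul_sum, h2 a]
    simp only [h3]
    exact h4 _
  have e3 : ∑ c, (1 / 2) * (J p * (G p)⁻¹ * matDeriv (Pi.single c 1) G p).trace * S p c β
      = (1 / 2) * (K p * (H p)⁻¹ * matDeriv (fun a => S p a β) H p).trace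
        + (K p * (matDeriv (fun a => S p a β) T p * S p)).trace := by
    rw [Finset.sum_congr rfl fun c (_ : c ∈ Finset.univ) => mul_assoc (1 / 2 : ℝ) _ _,
      ← Finset.mul_sum, trG, hJp, tr_eq _ hHK]
    ring
  simp only [formPhi_eq hs hdet hJ dG dJ, sub_mul, add_mul, Finset.sum_sub_distrib,
    Finset.sum_add_distrib]
  simp only [add_mul, Finset.sum_add_distrib] at e2
  rw [e1, e2, e3]
  ring

end Coordinates

/-! ### Smooth Riemannian metrics on open subsets of ℝⁿ. -/

section LocalMetric

variable {n : ℕ}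

/-- A smooth Riemannian metric on the open set `U` of `ℝⁿ`. -/
structure IsLocalMetric (h : (Fin n → ℝ) → Matrix (Fin n) (Fin n) ℝ) (U : Set (Fin n → ℝ)) :
    Prop where
  isOpen : IsOpen U
  symm : ∀ x, (h x)ᵀ = h x
  posDef : ∀ x ∈ U, (h x).PosDef
  smooth : ∀ i j, ContDiffOn ℝ ∞ (fun x => h x i j) U

variable {h : (Fin n → ℝ) → Matrix (Fin n) (Fin n) ℝ} {U : Set (Fin n → ℝ)}

namespace IsLocalMetric

theorem apply_comm (H : IsLocalMetric h U) (x : Fin n → ℝ) (i j : Fin n) : h x i j = h x j i :=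
  congrFun (congrFun (H.symm x).symm i) j

theorem isUnit_det (H : IsLocalMetric h U) {x : Fin n → ℝ} (hx : x ∈ U) : IsUnit (h x).det :=
  (H.posDef x hx).det_pos.ne'.isUnit

theorem contDiffAt (H : IsLocalMetric h U) {x : Fin n → ℝ} (hx : x ∈ U) (i j : Fin n) :
    ContDiffAt ℝ ∞ (fun x => h x i j) x :=
  (H.smooth i j).contDiffAt (H.isOpen.mem_nhds hx)

theorem entryDiff (H : IsLocalMetric h U) {x : Fin n → ℝ} (hx : x ∈ U) : EntryDiff h x :=
  fun i j => (H.contDiffAt hx i j).differentiableAt (by simp)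

end IsLocalMetric

theorem contDiffAt_det {m : ℕ} {E : Type*} [NormedAddCommGroup E] [NormedSpace ℝ E]
    {A : E → Matrix (Fin m) (Fin m) ℝ} {x : E}
    (hA : ∀ i j, ContDiffAt ℝ ∞ (fun x => A x i j) x) : ContDiffAt ℝ ∞ (fun x => (A x).det) x := by
  simp only [Matrix.det_apply']
  exact ContDiffAt.sum fun σ _ => contDiffAt_const.mul (contDiffAt_prod fun i _ => hA _ _)

theorem contDiffAt_inv {m : ℕ} {E : Type*} [NormedAddCommGroup E] [NormedSpace ℝ E]
    {A : E → Matrix (Fin m) (Fin m) ℝ} {x : E}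
    (hA : ∀ i j, ContDiffAt ℝ ∞ (fun x => A x i j) x) (hdet : (A x).det ≠ 0) (i j : Fin m) :
    ContDiffAt ℝ ∞ (fun x => (A x)⁻¹ i j) x := by
  -- Cramer's rule reduces smoothness of the inverse to smoothness of determinants.
  have : ∀ x, (A x)⁻¹ i j = ((A x).det)⁻¹ * ((A x).updateRow j (Pi.single i 1)).det := by
    intro x
    rw [Matrix.inv_def, Matrix.smul_apply, Matrix.adjugate_apply, Ring.inverse_eq_inv', smul_eq_mul]
  simp only [this]
  refine ((contDiffAt_det hA).inv hdet).mul (contDiffAt_det fun k l => ?_)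
  by_cases hk : k = j
  · subst hk
    simpa using contDiffAt_const
  · simpa [Matrix.updateRow_ne hk] using hA k l

theorem contDiffAt_pderiv {f : (Fin n → ℝ) → ℝ} {x : Fin n → ℝ} (hf : ContDiffAt ℝ ∞ f x)
    (i : Fin n) : ContDiffAt ℝ ∞ (pderiv i f) x :=
  (hf.fderiv_right (m := ∞) (by simp)).clm_apply contDiffAt_const

namespace IsLocalMetric

theorem contDiffAt_christoffel (H : IsLocalMetric h U) {x : Fin n → ℝ} (hx : x ∈ U)
    (k i j : Fin n) : ContDiffAt ℝ ∞ (christoffel h k i j) x := by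
  unfold christoffel
  refine contDiffAt_const.mul (ContDiffAt.sum fun l _ => ?_)
  exact (contDiffAt_inv (H.contDiffAt hx) (H.isUnit_det hx).ne_zero k l).mul
    (((contDiffAt_pderiv (H.contDiffAt hx _ _) _).add
      (contDiffAt_pderiv (H.contDiffAt hx _ _) _)).sub (contDiffAt_pderiv (H.contDiffAt hx _ _) _))

theorem christoffel_comm (H : IsLocalMetric h U) (x : Fin n → ℝ) (k i j : Fin n) :
    christoffel h k i j x = christoffel h k j i x :=
  NaturalLift.christoffel_comm (Filter.Eventually.of_forall H.symm) k i j

theorem matDeriv_metric (H : IsLocalMetric h U) {x : Fin n → ℝ} (hx : x ∈ U) (i : Fin n) :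
    matDeriv (Pi.single i 1) h x
      = h x * christoffelMatrix h i x + (christoffelMatrix h i x)ᵀ * h x :=
  NaturalLift.matDeriv_metric (Filter.Eventually.of_forall H.symm) (H.isUnit_det hx) i

end IsLocalMetric

end LocalMetric

/-! ### Horizontal and vertical derivatives of the energy density, of y♭ and of natural blocks. -/

section LiftDerivative

variable {n : ℕ} {h : (Fin n → ℝ) → Matrix (Fin n) (Fin n) ℝ} {U : Set (Fin n → ℝ)}
  {p : TangentCoord n}

theorem hasFDerivAt_base (p : TangentCoord n) : HasFDerivAt (base (n := n))
    (ContinuousLinearMap.pi fun i => ContinuousLinearMap.proj (R := ℝ) (Sum.inl i)) p :=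
  (ContinuousLinearMap.pi fun i =>
    ContinuousLinearMap.proj (R := ℝ) (φ := fun _ : Fin n ⊕ Fin n => ℝ) (Sum.inl i)).hasFDerivAt

theorem fderiv_comp_base {f : (Fin n → ℝ) → ℝ} (hf : DifferentiableAt ℝ f (base p))
    (v : TangentCoord n) :
    fderiv ℝ (fun q => f (base q)) p v = fderiv ℝ f (base p) (base v) := by
  have : HasFDerivAt (fun q : TangentCoord n => f (base q)) _ p :=
    hf.hasFDerivAt.comp p (hasFDerivAt_base p)
  rw [this.fderiv]
  rfl

theorem differentiableAt_comp_base {f : (Fin n → ℝ) → ℝ} (hf : DifferentiableAt ℝ f (base p)) :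
    DifferentiableAt ℝ (fun q : TangentCoord n => f (base q)) p :=
  hf.comp p (hasFDerivAt_base p).differentiableAt

theorem differentiableAt_fibre (k : Fin n) :
    DifferentiableAt ℝ (fun q : TangentCoord n => fibre q k) p :=
  differentiableAt_apply (𝕜 := ℝ) (Sum.inr k) p

theorem fderiv_fibre (k : Fin n) (v : TangentCoord n) :
    fderiv ℝ (fun q : TangentCoord n => fibre q k) p v = fibre v k := by
  have : (fun q : TangentCoord n => fibre q k)
    = ContinuousLinearMap.proj (R := ℝ) (φ := fun _ : Fin n ⊕ Fin n => ℝ) (Sum.inr k) := rfl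
  rw [this, ContinuousLinearMap.fderiv]
  rfl

namespace IsLocalMetric

theorem differentiableAt_lowered (H : IsLocalMetric h U) (hp : base p ∈ U) (i : Fin n) :
    DifferentiableAt ℝ (fun q => lowered h q i) p := by
  unfold lowered
  exact DifferentiableAt.fun_sum fun k _ => (differentiableAt_fibre k).mul
    (differentiableAt_comp_base (H.entryDiff hp k i))

theorem fderiv_lowered (H : IsLocalMetric h U) (hp : base p ∈ U) (i : Fin n)
    (v : TangentCoord n) : fderiv ℝ (fun q => lowered h q i) p v
      = ∑ k, fibre v k * h (base p) k i + ∑ k, fibre p k * matDeriv (base v) h (base p) k i := by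
  have hd : ∀ k ∈ Finset.univ, DifferentiableAt ℝ (fun q => fibre q k * h (base q) k i) p :=
    fun k _ => (differentiableAt_fibre k).mul (differentiableAt_comp_base (H.entryDiff hp k i))
  unfold lowered
  rw [fderiv_fun_sum hd, _root_.sum_apply, ← Finset.sum_add_distrib]
  refine Finset.sum_congr rfl fun k _ => ?_
  have h1 : DifferentiableAt ℝ (fun q : TangentCoord n => h (base q) k i) p :=
    differentiableAt_comp_base (H.entryDiff hp k i)
  rw [fderiv_fun_mul (differentiableAt_fibre k) h1]
  simp only [_root_.add_apply, _root_.smul_apply, smul_eq_mul, fderiv_fibre,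
    fderiv_comp_base (H.entryDiff hp k i), matDeriv_apply]
  ring

end IsLocalMetric

theorem energy_eq (q : TangentCoord n) : energy h q = (1 / 2) * ∑ k, lowered h q k * fibre q k := by
  unfold energy lowered
  rw [Finset.sum_comm]
  simp only [Finset.sum_mul]
  congr 1
  exact Finset.sum_congr rfl fun k _ => Finset.sum_congr rfl fun i _ => by ring

namespace IsLocalMetric

theorem differentiableAt_energy (H : IsLocalMetric h U) (hp : base p ∈ U) :
    DifferentiableAt ℝ (energy h) p := by
  have : energy h = fun q => (1 / 2) * ∑ k, lowered h q k * fibre q k := funext energy_eq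
  rw [this]
  exact (DifferentiableAt.fun_sum fun k _ => (H.differentiableAt_lowered hp k).mul
    (differentiableAt_fibre k)).const_mul _

theorem fderiv_energy (H : IsLocalMetric h U) (hp : base p ∈ U) (v : TangentCoord n) :
    fderiv ℝ (energy h) p v = (1 / 2) * ∑ k, (lowered h p k * fibre v k
      + fderiv ℝ (fun q => lowered h q k) p v * fibre p k) := by
  have : energy h = fun q => (1 / 2) * ∑ k, lowered h q k * fibre q k := funext energy_eq
  have hd : ∀ k ∈ Finset.univ, DifferentiableAt ℝ (fun q => lowered h q k * fibre q k) p :=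
    fun k _ => (H.differentiableAt_lowered hp k).mul (differentiableAt_fibre k)
  rw [this, fderiv_const_mul (DifferentiableAt.fun_sum hd), fderiv_fun_sum hd]
  simp only [_root_.smul_apply, _root_.sum_apply, smul_eq_mul]
  congr 1
  refine Finset.sum_congr rfl fun k _ => ?_
  rw [fderiv_fun_mul (H.differentiableAt_lowered hp k) (differentiableAt_fibre k)]
  simp only [_root_.add_apply, _root_.smul_apply, smul_eq_mul, fderiv_fibre]
  ring

end IsLocalMetric

/-- The horizontal lift of `∂/∂x^i`. -/
def hor (h : (Fin n → ℝ) → Matrix (Fin n) (Fin n) ℝ) (p : TangentCoord n) (i : Fin n) :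
    TangentCoord n := fun a => adaptedFrame h p a (Sum.inl i)

/-- The vertical lift of `∂/∂x^i`. -/
def ver (h : (Fin n → ℝ) → Matrix (Fin n) (Fin n) ℝ) (p : TangentCoord n) (i : Fin n) :
    TangentCoord n := fun a => adaptedFrame h p a (Sum.inr i)

theorem base_hor (i : Fin n) : base (hor h p i) = Pi.single i 1 := by
  ext j
  simp [base, hor, adaptedFrame, Matrix.one_apply, Pi.single_apply]

theorem fibre_hor (i k : Fin n) : fibre (hor h p i) k = -connection h p k i := by
  simp [fibre, hor, adaptedFrame]

theorem base_ver (i : Fin n) : base (ver h p i) = 0 := by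
  ext j
  simp [base, ver, adaptedFrame]

theorem fibre_ver (i : Fin n) : fibre (ver h p i) = Pi.single i 1 := by
  ext j
  simp [fibre, ver, adaptedFrame, Matrix.one_apply, Pi.single_apply]

theorem ver_eq (i : Fin n) : ver h p i = Pi.single (Sum.inr i) 1 := by
  ext a
  rcases a with a | a <;> simp [ver, adaptedFrame, Matrix.one_apply, Pi.single_apply]

theorem matDeriv_zero {l m : Type} (A : (Fin n → ℝ) → Matrix l m ℝ) (x : Fin n → ℝ) :
    matDeriv 0 A x = 0 := by
  ext i j
  simp [matDeriv_apply]

namespace IsLocalMetric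

theorem connection_apply (H : IsLocalMetric h U) (k i : Fin n) :
    connection h p k i = ∑ j, christoffelMatrix h i (base p) k j * fibre p j := by
  simp only [connection, Matrix.of_apply, christoffelMatrix]
  exact Finset.sum_congr rfl fun j _ => by rw [H.christoffel_comm, mul_comm]

theorem lowered_eq (H : IsLocalMetric h U) (i : Fin n) :
    lowered h p i = ∑ k, h (base p) i k * fibre p k :=
  Finset.sum_congr rfl fun k _ => by rw [H.apply_comm, mul_comm]

/-- Of the two Christoffel terms in the derivative of g, one is cancelled by the horizontal
variation of y. What is left says that y♭ is parallel along horizontal directions. -/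
theorem fderiv_lowered_hor (H : IsLocalMetric h U) (hp : base p ∈ U) (i j : Fin n) :
    fderiv ℝ (fun q => lowered h q j) p (hor h p i)
      = ∑ l, lowered h p l * christoffelMatrix h i (base p) l j := by
  rw [H.fderiv_lowered hp, base_hor, H.matDeriv_metric hp]
  simp only [fibre_hor, H.connection_apply, lowered, Matrix.add_apply, Matrix.mul_apply, mul_add,
    Finset.sum_add_distrib, Matrix.transpose_apply, Finset.sum_mul, Finset.mul_sum, neg_mul,
    Finset.sum_neg_distrib]
  have e : ∑ x, ∑ y, christoffelMatrix h i (base p) x y * fibre p y * h (base p) x j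
      = ∑ x, ∑ y, fibre p x * (christoffelMatrix h i (base p) y x * h (base p) y j) := by
    rw [Finset.sum_comm]
    exact Finset.sum_congr rfl fun k _ => Finset.sum_congr rfl fun i _ => by ring
  rw [e, Finset.sum_comm (f := fun l k => fibre p k * h (base p) k l * _)]
  simp only [mul_assoc]
  ring

/-- Infinitesimally, parallel transport preserves length: the contributions of y and of y♭ are
opposite. -/
theorem fderiv_energy_hor (H : IsLocalMetric h U) (hp : base p ∈ U) (i : Fin n) :
    fderiv ℝ (energy h) p (hor h p i) = 0 := by
  rw [H.fderiv_energy hp]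
  simp only [H.fderiv_lowered_hor hp, fibre_hor, H.connection_apply, Finset.sum_add_distrib,
    mul_neg, Finset.sum_neg_distrib, Finset.mul_sum, Finset.sum_mul]
  rw [Finset.sum_comm (f := fun k l => lowered h p l * _ * _)]
  simp only [mul_assoc]
  ring

theorem fderiv_lowered_ver (H : IsLocalMetric h U) (hp : base p ∈ U) (i j : Fin n) :
    fderiv ℝ (fun q => lowered h q j) p (ver h p i) = h (base p) i j := by
  rw [H.fderiv_lowered hp, base_ver, matDeriv_zero, fibre_ver]
  simp [Pi.single_apply]

theorem fderiv_energy_ver (H : IsLocalMetric h U) (hp : base p ∈ U) (i : Fin n) :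
    fderiv ℝ (energy h) p (ver h p i) = lowered h p i := by
  rw [H.fderiv_energy hp]
  simp only [H.fderiv_lowered_ver hp, fibre_ver, Finset.sum_add_distrib, ← H.lowered_eq]
  simp [Pi.single_apply]
  ring

end IsLocalMetric

theorem fderiv_comp_energy {f : ℝ → ℝ} (H : IsLocalMetric h U) (hp : base p ∈ U)
    (hf : DifferentiableAt ℝ f (energy h p)) (v : TangentCoord n) :
    fderiv ℝ (fun q => f (energy h q)) p v = deriv f (energy h p) * fderiv ℝ (energy h) p v := by
  have : HasFDerivAt (fun q => f (energy h q)) _ p :=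
    hf.hasDerivAt.comp_hasFDerivAt p (H.differentiableAt_energy hp).hasFDerivAt
  rw [this.fderiv]
  simp

namespace IsLocalMetric

theorem differentiableAt_comp_energy {f : ℝ → ℝ} (H : IsLocalMetric h U) (hp : base p ∈ U)
    (hf : DifferentiableAt ℝ f (energy h p)) : DifferentiableAt ℝ (fun q => f (energy h q)) p :=
  hf.comp p (H.differentiableAt_energy hp)

variable {a b : ℝ → ℝ}

theorem entryDiff_endoBlock (H : IsLocalMetric h U) (hp : base p ∈ U)
    (ha : DifferentiableAt ℝ a (energy h p)) (hb : DifferentiableAt ℝ b (energy h p)) :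
    EntryDiff (endoBlock h a b) p := by
  intro k i
  simp only [endoBlock, Matrix.of_apply]
  exact ((H.differentiableAt_comp_energy hp ha).mul_const _).add
    (((H.differentiableAt_comp_energy hp hb).mul (differentiableAt_fibre k)).mul
      (H.differentiableAt_lowered hp i))

theorem matDeriv_endoBlock (H : IsLocalMetric h U) (hp : base p ∈ U)
    (ha : DifferentiableAt ℝ a (energy h p)) (hb : DifferentiableAt ℝ b (energy h p))
    (v : TangentCoord n) (k i : Fin n) :
    matDeriv v (endoBlock h a b) p k i
      = deriv a (energy h p) * fderiv ℝ (energy h) p v * (1 : Matrix (Fin n) (Fin n) ℝ) k i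
        + deriv b (energy h p) * fderiv ℝ (energy h) p v * fibre p k * lowered h p i
        + b (energy h p) * (fibre v k * lowered h p i
          + fibre p k * fderiv ℝ (fun q => lowered h q i) p v) := by
  have da := H.differentiableAt_comp_energy hp ha
  have db := H.differentiableAt_comp_energy hp hb
  have dy := differentiableAt_fibre (p := p) k
  have dl := H.differentiableAt_lowered hp i
  rw [matDeriv_apply]
  simp only [endoBlock, Matrix.of_apply]
  have dby : DifferentiableAt ℝ (fun q => b (energy h q) * fibre q k) p := db.mul dy
  have dbl : DifferentiableAt ℝ (fun q => b (energy h q) * fibre q k * lowered h q i) p := dby.mul dl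
  rw [fderiv_fun_add (da.mul_const _) dbl, fderiv_mul_const da, fderiv_fun_mul dby dl,
    fderiv_fun_mul db dy]
  simp only [_root_.add_apply, _root_.smul_apply, smul_eq_mul, fderiv_fibre,
    fderiv_comp_energy H hp ha, fderiv_comp_energy H hp hb]
  ring

theorem entryDiff_formBlock (H : IsLocalMetric h U) (hp : base p ∈ U)
    (ha : DifferentiableAt ℝ a (energy h p)) (hb : DifferentiableAt ℝ b (energy h p)) :
    EntryDiff (formBlock h a b) p := by
  intro k i
  simp only [formBlock, Matrix.of_apply]
  exact ((H.differentiableAt_comp_energy hp ha).mul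
    (differentiableAt_comp_base (H.entryDiff hp k i))).add
    (((H.differentiableAt_comp_energy hp hb).mul (H.differentiableAt_lowered hp k)).mul
      (H.differentiableAt_lowered hp i))

theorem matDeriv_formBlock (H : IsLocalMetric h U) (hp : base p ∈ U)
    (ha : DifferentiableAt ℝ a (energy h p)) (hb : DifferentiableAt ℝ b (energy h p))
    (v : TangentCoord n) (k i : Fin n) :
    matDeriv v (formBlock h a b) p k i
      = deriv a (energy h p) * fderiv ℝ (energy h) p v * h (base p) k i
        + a (energy h p) * matDeriv (base v) h (base p) k i
        + deriv b (energy h p) * fderiv ℝ (energy h) p v * lowered h p k * lowered h p i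
        + b (energy h p) * (fderiv ℝ (fun q => lowered h q k) p v * lowered h p i
          + lowered h p k * fderiv ℝ (fun q => lowered h q i) p v) := by
  have da := H.differentiableAt_comp_energy hp ha
  have db := H.differentiableAt_comp_energy hp hb
  have dh : DifferentiableAt ℝ (fun q : TangentCoord n => h (base q) k i) p :=
    differentiableAt_comp_base (H.entryDiff hp k i)
  have dy := H.differentiableAt_lowered hp k
  have dl := H.differentiableAt_lowered hp i
  rw [matDeriv_apply]
  simp only [formBlock, Matrix.of_apply]
  have dah : DifferentiableAt ℝ (fun q => a (energy h q) * h (base q) k i) p := da.mul dh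
  have dby : DifferentiableAt ℝ (fun q => b (energy h q) * lowered h q k) p := db.mul dy
  have dbl : DifferentiableAt ℝ (fun q => b (energy h q) * lowered h q k * lowered h q i) p :=
    dby.mul dl
  rw [fderiv_fun_add dah dbl, fderiv_fun_mul da dh, fderiv_fun_mul dby dl, fderiv_fun_mul db dy]
  simp only [_root_.add_apply, _root_.smul_apply, smul_eq_mul,
    fderiv_comp_base (H.entryDiff hp k i), matDeriv_apply,
    fderiv_comp_energy H hp ha, fderiv_comp_energy H hp hb]
  ring

/-- Horizontal derivatives of natural endomorphism blocks. -/
theorem matDeriv_endoBlock_hor (H : IsLocalMetric h U) (hp : base p ∈ U)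
    (ha : DifferentiableAt ℝ a (energy h p)) (hb : DifferentiableAt ℝ b (energy h p)) (i : Fin n) :
    matDeriv (hor h p i) (endoBlock h a b) p
      = endoBlock h a b p * christoffelMatrix h i (base p)
        - christoffelMatrix h i (base p) * endoBlock h a b p := by
  ext k j
  rw [H.matDeriv_endoBlock hp ha hb, H.fderiv_energy_hor hp, H.fderiv_lowered_hor hp, fibre_hor,
    H.connection_apply]
  simp only [endoBlock, Matrix.sub_apply, Matrix.mul_apply, Matrix.of_apply, add_mul, mul_add,
    Finset.sum_add_distrib, Matrix.one_apply, Finset.mul_sum, Finset.sum_mul, neg_mul]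
  simp only [mul_ite, ite_mul, mul_one, mul_zero, zero_mul, Finset.sum_ite_eq, Finset.sum_ite_eq',
    Finset.mem_univ, if_true]
  simp only [mul_neg, Finset.mul_sum, mul_comm, mul_left_comm, mul_assoc, ite_self]
  ring

/-- Horizontal derivatives of natural forms. -/
theorem matDeriv_formBlock_hor (H : IsLocalMetric h U) (hp : base p ∈ U)
    (ha : DifferentiableAt ℝ a (energy h p)) (hb : DifferentiableAt ℝ b (energy h p)) (i : Fin n) :
    matDeriv (hor h p i) (formBlock h a b) p
      = formBlock h a b p * christoffelMatrix h i (base p)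
        + (christoffelMatrix h i (base p))ᵀ * formBlock h a b p := by
  ext k j
  rw [H.matDeriv_formBlock hp ha hb, H.fderiv_energy_hor hp, H.fderiv_lowered_hor hp,
    H.fderiv_lowered_hor hp, base_hor, H.matDeriv_metric hp]
  simp only [formBlock, Matrix.add_apply, Matrix.mul_apply, Matrix.of_apply, add_mul, mul_add,
    Finset.sum_add_distrib, Finset.mul_sum, Finset.sum_mul, Matrix.transpose_apply]
  simp only [mul_comm, mul_left_comm, mul_assoc]
  ring

end IsLocalMetric

end LiftDerivative

/-! ### The adapted frame, its non-integrability, and the components of J and G in it. -/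

section FrameComponents

variable {n : ℕ} {h : (Fin n → ℝ) → Matrix (Fin n) (Fin n) ℝ} {U : Set (Fin n → ℝ)}
  {p : TangentCoord n}

namespace IsLocalMetric

theorem differentiableAt_connection_term (H : IsLocalMetric h U) (hp : base p ∈ U)
    (k j i : Fin n) :
    DifferentiableAt ℝ (fun q => fibre q j * christoffel h k j i (base q)) p :=
  (differentiableAt_fibre j).mul (differentiableAt_comp_base
    ((H.contDiffAt_christoffel hp k j i).differentiableAt (by simp)))

theorem entryDiff_connection (H : IsLocalMetric h U) (hp : base p ∈ U) :
    EntryDiff (connection h) p := by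
  intro k i
  simp only [connection, Matrix.of_apply]
  exact DifferentiableAt.fun_sum fun j _ => H.differentiableAt_connection_term hp k j i

theorem matDeriv_connection (H : IsLocalMetric h U) (hp : base p ∈ U) (v : TangentCoord n)
    (k i : Fin n) : matDeriv v (connection h) p k i
      = ∑ j, (fibre v j * christoffel h k j i (base p)
        + fibre p j * fderiv ℝ (christoffel h k j i) (base p) (base v)) := by
  have hd : ∀ j ∈ Finset.univ,
      DifferentiableAt ℝ (fun q => fibre q j * christoffel h k j i (base q)) p :=
    fun j _ => H.differentiableAt_connection_term hp k j i
  rw [matDeriv_apply]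
  simp only [connection, Matrix.of_apply]
  rw [fderiv_fun_sum hd, _root_.sum_apply]
  refine Finset.sum_congr rfl fun j _ => ?_
  have hc := (H.contDiffAt_christoffel hp k j i).differentiableAt (by simp)
  rw [fderiv_fun_mul (differentiableAt_fibre j) (differentiableAt_comp_base hc)]
  simp only [_root_.add_apply, _root_.smul_apply, smul_eq_mul, fderiv_fibre, fderiv_comp_base hc]
  ring

theorem matDeriv_connection_ver (H : IsLocalMetric h U) (hp : base p ∈ U) (i : Fin n) :
    matDeriv (ver h p i) (connection h) p = christoffelMatrix h i (base p) := by
  ext k j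
  rw [H.matDeriv_connection hp, fibre_ver, base_ver]
  simp [Pi.single_apply, christoffelMatrix]

/-- The curvature measures the non-integrability of the horizontal distribution. -/
theorem matDeriv_connection_hor_sub (H : IsLocalMetric h U) (hp : base p ∈ U) (k i j : Fin n) :
    matDeriv (hor h p i) (connection h) p k j - matDeriv (hor h p j) (connection h) p k i
      = ∑ l, fibre p l * curvature h k l i j (base p) := by
  have hG : ∀ k l j, christoffel h k l j = christoffel h k j l :=
    fun k l j => funext fun x => H.christoffel_comm x k l j
  rw [H.matDeriv_connection hp, H.matDeriv_connection hp]
  simp only [base_hor, fibre_hor, curvature, pderiv, mul_add, mul_sub, Finset.sum_add_distrib,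
    Finset.sum_sub_distrib, connection, Matrix.of_apply, Finset.mul_sum, Finset.sum_mul, neg_mul,
    Finset.sum_neg_distrib, hG k _ i, hG k _ j, hG _ _ i, hG _ _ j]
  have e : ∀ i j, ∑ x, ∑ y, fibre p y * christoffel h x i y (base p) * christoffel h k j x (base p)
      = ∑ x, ∑ y, fibre p x * (christoffel h k j y (base p) * christoffel h y i x (base p)) := by
    intro i j
    rw [Finset.sum_comm]
    exact Finset.sum_congr rfl fun k _ => Finset.sum_congr rfl fun i _ => by ring
  rw [e, e]
  ring

end IsLocalMetric

theorem entryDiff_const {l m : Type} (A : Matrix l m ℝ) :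
    EntryDiff (fun _ : TangentCoord n => A) p := fun _ _ => differentiableAt_const _

theorem EntryDiff.neg {l m : Type} {A : TangentCoord n → Matrix l m ℝ} (hA : EntryDiff A p) :
    EntryDiff (fun q => -A q) p := fun a b => (hA a b).neg

theorem matDeriv_neg {l m : Type} (A : TangentCoord n → Matrix l m ℝ) (v : TangentCoord n) :
    matDeriv v (fun q => -A q) p = -matDeriv v A p := by
  ext a b
  simp [matDeriv_apply]

theorem EntryDiff.fromBlocks {A B C D : TangentCoord n → Matrix (Fin n) (Fin n) ℝ}
    (hA : EntryDiff A p) (hB : EntryDiff B p) (hC : EntryDiff C p) (hD : EntryDiff D p) :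
    EntryDiff (fun q => Matrix.fromBlocks (A q) (B q) (C q) (D q)) p := by
  rintro (a | a) (b | b)
  exacts [hA a b, hB a b, hC a b, hD a b]

theorem matDeriv_fromBlocks (A B C D : TangentCoord n → Matrix (Fin n) (Fin n) ℝ)
    (v : TangentCoord n) : matDeriv v (fun q => Matrix.fromBlocks (A q) (B q) (C q) (D q)) p
      = Matrix.fromBlocks (matDeriv v A p) (matDeriv v B p) (matDeriv v C p) (matDeriv v D p) := by
  ext (a | a) (b | b) <;> rfl

theorem matDeriv_const {l m : Type} (A : Matrix l m ℝ) (v : TangentCoord n) :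
    matDeriv v (fun _ => A) p = 0 := by
  ext a b
  simp [matDeriv_apply]

theorem matDeriv_adaptedCoframe (v : TangentCoord n) : matDeriv v (adaptedCoframe h) p
    = Matrix.fromBlocks 0 0 (matDeriv v (connection h) p) 0 := by
  unfold adaptedCoframe
  rw [matDeriv_fromBlocks (fun _ => 1) (fun _ => 0) _ (fun _ => 1), matDeriv_const, matDeriv_const]

theorem matDeriv_adaptedFrame (v : TangentCoord n) : matDeriv v (adaptedFrame h) p
    = Matrix.fromBlocks 0 0 (-matDeriv v (connection h) p) 0 := by
  unfold adaptedFrame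
  rw [matDeriv_fromBlocks (fun _ => 1) (fun _ => 0) (fun q => -connection h q) (fun _ => 1),
    matDeriv_const, matDeriv_const, matDeriv_neg]

theorem IsLocalMetric.entryDiff_adaptedCoframe (H : IsLocalMetric h U) (hp : base p ∈ U) :
    EntryDiff (adaptedCoframe h) p :=
  (entryDiff_const 1).fromBlocks (entryDiff_const 0) (H.entryDiff_connection hp) (entryDiff_const 1)

theorem IsLocalMetric.entryDiff_adaptedFrame (H : IsLocalMetric h U) (hp : base p ∈ U) :
    EntryDiff (adaptedFrame h) p :=
  (entryDiff_const 1).fromBlocks (entryDiff_const 0) (H.entryDiff_connection hp).neg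
    (entryDiff_const 1)

/-- The components of `J` in the adapted frame. -/
def frameJ (h : (Fin n → ℝ) → Matrix (Fin n) (Fin n) ℝ) (κ : Coefficients) (p : TangentCoord n) :
    Matrix (Fin n ⊕ Fin n) (Fin n ⊕ Fin n) ℝ :=
  Matrix.fromBlocks (endoBlock h κ.a₄ κ.b₄ p) (-endoBlock h κ.a₂ κ.b₂ p)
      (endoBlock h κ.a₁ κ.b₁ p) (endoBlock h κ.a₃ κ.b₃ p)

/-- The components of `G` in the adapted frame. -/
def frameG (h : (Fin n → ℝ) → Matrix (Fin n) (Fin n) ℝ) (κ : Coefficients) (p : TangentCoord n) :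
    Matrix (Fin n ⊕ Fin n) (Fin n ⊕ Fin n) ℝ :=
  Matrix.fromBlocks (formBlock h κ.c₁ κ.d₁ p) (formBlock h κ.c₃ κ.d₃ p)
      (formBlock h κ.c₃ κ.d₃ p) (formBlock h κ.c₂ κ.d₂ p)

theorem adaptedCoframe_mul_adaptedFrame (p : TangentCoord n) :
    adaptedCoframe h p * adaptedFrame h p = 1 :=
  mul_eq_one_comm.mp (adaptedFrame_mul_adaptedCoframe h p)

/-- The natural lifts of `h` to `U × ℝⁿ` form an almost anti-Hermitian structure. -/
def IsLocalStructure (κ : Coefficients) (h : (Fin n → ℝ) → Matrix (Fin n) (Fin n) ℝ)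
    (U : Set (Fin n → ℝ)) : Prop :=
  ∀ p : TangentCoord n, base p ∈ U →
    liftJ h κ p * liftJ h κ p = -1 ∧ (liftG h κ p).det ≠ 0 ∧
    (liftJ h κ p)ᵀ * liftG h κ p * liftJ h κ p = -liftG h κ p

/-- Multiply JᵀGJ = -G by J on the right and use J² = -1. -/
theorem mul_symm_of_antiHermitian {ι : Type} [Fintype ι] [DecidableEq ι] {J G : Matrix ι ι ℝ}
    (h1 : J * J = -1) (h2 : Jᵀ * G * J = -G) : G * J = Jᵀ * G := by
  have : Jᵀ * G * (J * J) = -(G * J) := by rw [← Matrix.mul_assoc, h2, Matrix.neg_mul]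
  rw [h1] at this
  simpa using this.symm

theorem IsLocalMetric.formBlock_symm (H : IsLocalMetric h U) (c d : ℝ → ℝ) (p : TangentCoord n) :
    (formBlock h c d p)ᵀ = formBlock h c d p := by
  ext i j
  simp only [formBlock, Matrix.transpose_apply, Matrix.of_apply, H.apply_comm _ i j]
  ring

theorem IsLocalMetric.liftG_symm (H : IsLocalMetric h U) (κ : Coefficients) (p : TangentCoord n) :
    (liftG h κ p)ᵀ = liftG h κ p := by
  unfold liftG
  simp only [Matrix.transpose_mul, Matrix.transpose_transpose, Matrix.fromBlocks_transpose,
    H.formBlock_symm, Matrix.mul_assoc]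

theorem liftJ_eq (κ : Coefficients) :
    liftJ h κ = fun q => adaptedFrame h q * frameJ h κ q * adaptedCoframe h q := rfl

theorem liftG_eq (κ : Coefficients) :
    liftG h κ = fun q => (adaptedCoframe h q)ᵀ * frameG h κ q * adaptedCoframe h q := rfl

theorem frameJ_eq (κ : Coefficients) (p : TangentCoord n) :
    frameJ h κ p = adaptedCoframe h p * liftJ h κ p * adaptedFrame h p := by
  rw [liftJ_eq]
  simp only [Matrix.mul_assoc, adaptedCoframe_mul_adaptedFrame, Matrix.mul_one]
  rw [← Matrix.mul_assoc, adaptedCoframe_mul_adaptedFrame, Matrix.one_mul]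

theorem frameG_eq (κ : Coefficients) (p : TangentCoord n) :
    frameG h κ p = (adaptedFrame h p)ᵀ * liftG h κ p * adaptedFrame h p := by
  rw [liftG_eq]
  simp only [Matrix.mul_assoc, adaptedCoframe_mul_adaptedFrame, Matrix.mul_one]
  rw [← Matrix.mul_assoc, ← Matrix.transpose_mul, adaptedCoframe_mul_adaptedFrame,
    Matrix.transpose_one, Matrix.one_mul]

variable {κ : Coefficients}

namespace IsLocalStructure

theorem frameJ_mul_self (hS : IsLocalStructure κ h U) (hp : base p ∈ U) :
    frameJ h κ p * frameJ h κ p = -1 := by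
  have h1 := (hS p hp).1
  have : frameJ h κ p * frameJ h κ p
      = adaptedCoframe h p * (liftJ h κ p * liftJ h κ p) * adaptedFrame h p := by
    rw [frameJ_eq]
    simp only [Matrix.mul_assoc]
    rw [← Matrix.mul_assoc (adaptedFrame h p) (adaptedCoframe h p),
      adaptedFrame_mul_adaptedCoframe, Matrix.one_mul]
  rw [this, h1, Matrix.mul_neg, Matrix.mul_one, Matrix.neg_mul, adaptedCoframe_mul_adaptedFrame]

theorem isUnit_det_frameG (hS : IsLocalStructure κ h U) (hp : base p ∈ U) :
    IsUnit (frameG h κ p).det := by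
  have h1 : IsUnit (adaptedFrame h p).det :=
    Matrix.isUnit_det_of_right_inverse (adaptedFrame_mul_adaptedCoframe h p)
  rw [frameG_eq, Matrix.det_mul, Matrix.det_mul, Matrix.det_transpose]
  exact (h1.mul (hS p hp).2.1.isUnit).mul h1

theorem frameG_mul_frameJ (hS : IsLocalStructure κ h U) (hp : base p ∈ U) :
    frameG h κ p * frameJ h κ p = (frameJ h κ p)ᵀ * frameG h κ p := by
  have h1 := mul_symm_of_antiHermitian (hS p hp).1 (hS p hp).2.2
  have e1 : frameG h κ p * frameJ h κ p
      = (adaptedFrame h p)ᵀ * (liftG h κ p * liftJ h κ p) * adaptedFrame h p := by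
    rw [frameJ_eq, frameG_eq]
    simp only [Matrix.mul_assoc]
    rw [← Matrix.mul_assoc (adaptedFrame h p) (adaptedCoframe h p),
      adaptedFrame_mul_adaptedCoframe, Matrix.one_mul]
  have e2 : (frameJ h κ p)ᵀ * frameG h κ p
      = (adaptedFrame h p)ᵀ * ((liftJ h κ p)ᵀ * liftG h κ p) * adaptedFrame h p := by
    rw [frameJ_eq, frameG_eq]
    simp only [Matrix.transpose_mul, Matrix.mul_assoc]
    rw [← Matrix.mul_assoc (adaptedCoframe h p)ᵀ (adaptedFrame h p)ᵀ, ← Matrix.transpose_mul,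
      adaptedFrame_mul_adaptedCoframe, Matrix.transpose_one, Matrix.one_mul]
  rw [e1, e2, h1]

end IsLocalStructure

/-- The coefficients are unconstrained at negative arguments, so two-sided derivatives are available
only for t > 0. For this reason Φ is computed only where y ≠ 0. -/
theorem Coefficients.Smooth.differentiableAt_of_pos {f : ℝ → ℝ}
    (hf : ContDiffOn ℝ ∞ f (Set.Ici 0)) {t : ℝ} (ht : 0 < t) : DifferentiableAt ℝ f t :=
  (hf.contDiffAt (Ici_mem_nhds ht)).differentiableAt (by simp)

end FrameComponents

/-! ### The components of Φ on horizontal and vertical lifts. -/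

section FormPhi

variable {n : ℕ} {h : (Fin n → ℝ) → Matrix (Fin n) (Fin n) ℝ} {U : Set (Fin n → ℝ)}
  {p : TangentCoord n} {κ : Coefficients}

/-- The hypothesis is vanishing torsion, which allows the derivative index to be exchanged with a
matrix index. The result is the horizontal divergence of a natural block, in the form in which it
cancels the frame corrections. -/
theorem sum_commutator_christoffel {Γ : Fin n → Matrix (Fin n) (Fin n) ℝ}
    (hΓ : ∀ i j k, Γ i k j = Γ j k i) (E : Matrix (Fin n) (Fin n) ℝ) (i : Fin n) :
    ∑ j, (E * Γ j - Γ j * E) j i = (E * Γ i).trace - ∑ j, (Γ j).trace * E j i := by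
  have e1 : ∑ j, (E * Γ j) j i = (E * Γ i).trace := by
    simp only [Matrix.trace, Matrix.diag_apply, Matrix.mul_apply]
    exact Finset.sum_congr rfl fun j _ => Finset.sum_congr rfl fun k _ => by rw [hΓ j i]
  have e2 : ∑ j, (Γ j * E) j i = ∑ j, (Γ j).trace * E j i := by
    simp only [Matrix.trace, Matrix.diag_apply, Matrix.mul_apply, Finset.sum_mul]
    rw [Finset.sum_comm]
    exact Finset.sum_congr rfl fun j _ => Finset.sum_congr rfl fun k _ => by rw [hΓ k j]
  simp only [Matrix.sub_apply, Finset.sum_sub_distrib, e1, e2]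

theorem trace_fromBlocks (A B C D : Matrix (Fin n) (Fin n) ℝ) :
    (Matrix.fromBlocks A B C D).trace = A.trace + D.trace := by
  simp [Matrix.trace]

theorem adaptedFrame_inl (i : Fin n) :
    (fun a => adaptedFrame h p a (Sum.inl i)) = hor h p i := rfl

theorem adaptedFrame_inr (i : Fin n) :
    (fun a => adaptedFrame h p a (Sum.inr i)) = ver h p i := rfl

/-- The vertical part of the logarithmic derivative of the volume density of `G`. -/
def volumeDeriv (h : (Fin n → ℝ) → Matrix (Fin n) (Fin n) ℝ) (κ : Coefficients)
    (p : TangentCoord n) (i : Fin n) : ℝ :=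
  (1 / 2) * ((frameG h κ p)⁻¹ * matDeriv (ver h p i) (frameG h κ) p).trace

theorem frame_mul_matDeriv_coframe (v : TangentCoord n) :
    matDeriv v (adaptedCoframe h) p * adaptedFrame h p
      = Matrix.fromBlocks 0 0 (matDeriv v (connection h) p) 0 := by
  rw [matDeriv_adaptedCoframe, adaptedFrame, Matrix.fromBlocks_multiply]
  simp

theorem frameJ_mul_fromBlocks (B : Matrix (Fin n) (Fin n) ℝ) :
    frameJ h κ p * Matrix.fromBlocks 0 0 B 0
      = Matrix.fromBlocks (-(endoBlock h κ.a₂ κ.b₂ p * B)) 0 (endoBlock h κ.a₃ κ.b₃ p * B) 0 := by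
  rw [frameJ, Matrix.fromBlocks_multiply]
  simp

theorem matDeriv_frameJ (v : TangentCoord n) : matDeriv v (frameJ h κ) p
    = Matrix.fromBlocks (matDeriv v (endoBlock h κ.a₄ κ.b₄) p)
      (-matDeriv v (endoBlock h κ.a₂ κ.b₂) p) (matDeriv v (endoBlock h κ.a₁ κ.b₁) p)
      (matDeriv v (endoBlock h κ.a₃ κ.b₃) p) := by
  unfold frameJ
  rw [matDeriv_fromBlocks (endoBlock h κ.a₄ κ.b₄) (fun q => -endoBlock h κ.a₂ κ.b₂ q), matDeriv_neg]

theorem matDeriv_frameG (v : TangentCoord n) : matDeriv v (frameG h κ) p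
    = Matrix.fromBlocks (matDeriv v (formBlock h κ.c₁ κ.d₁) p)
      (matDeriv v (formBlock h κ.c₃ κ.d₃) p) (matDeriv v (formBlock h κ.c₃ κ.d₃) p)
      (matDeriv v (formBlock h κ.c₂ κ.d₂) p) := by
  unfold frameG
  rw [matDeriv_fromBlocks]

namespace IsLocalMetric

open Coefficients.Smooth in
theorem matDeriv_frameG_hor (H : IsLocalMetric h U) (hκ : κ.Smooth) (hp : base p ∈ U)
    (ht : 0 < energy h p) (i : Fin n) : matDeriv (hor h p i) (frameG h κ) p
      = frameG h κ p * Matrix.fromBlocks (christoffelMatrix h i (base p)) 0 0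
          (christoffelMatrix h i (base p))
        + (Matrix.fromBlocks (christoffelMatrix h i (base p)) 0 0
          (christoffelMatrix h i (base p)))ᵀ * frameG h κ p := by
  have d := fun {f : ℝ → ℝ} (hf : ContDiffOn ℝ ∞ f (Set.Ici 0)) => differentiableAt_of_pos hf ht
  rw [matDeriv_frameG, H.matDeriv_formBlock_hor hp (d hκ.c₁) (d hκ.d₁),
    H.matDeriv_formBlock_hor hp (d hκ.c₂) (d hκ.d₂),
    H.matDeriv_formBlock_hor hp (d hκ.c₃) (d hκ.d₃), frameG, Matrix.fromBlocks_transpose,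
    Matrix.fromBlocks_multiply, Matrix.fromBlocks_multiply, Matrix.fromBlocks_add]
  simp

open Coefficients.Smooth in
theorem entryDiff_frameG (H : IsLocalMetric h U) (hκ : κ.Smooth) (hp : base p ∈ U)
    (ht : 0 < energy h p) : EntryDiff (frameG h κ) p := by
  have d := fun {f : ℝ → ℝ} (hf : ContDiffOn ℝ ∞ f (Set.Ici 0)) => differentiableAt_of_pos hf ht
  exact (H.entryDiff_formBlock hp (d hκ.c₁) (d hκ.d₁)).fromBlocks
    (H.entryDiff_formBlock hp (d hκ.c₃) (d hκ.d₃)) (H.entryDiff_formBlock hp (d hκ.c₃) (d hκ.d₃))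
    (H.entryDiff_formBlock hp (d hκ.c₂) (d hκ.d₂))

open Coefficients.Smooth in
theorem entryDiff_frameJ (H : IsLocalMetric h U) (hκ : κ.Smooth) (hp : base p ∈ U)
    (ht : 0 < energy h p) : EntryDiff (frameJ h κ) p := by
  have d := fun {f : ℝ → ℝ} (hf : ContDiffOn ℝ ∞ f (Set.Ici 0)) => differentiableAt_of_pos hf ht
  exact (H.entryDiff_endoBlock hp (d hκ.a₄) (d hκ.b₄)).fromBlocks
    (H.entryDiff_endoBlock hp (d hκ.a₂) (d hκ.b₂)).neg
    (H.entryDiff_endoBlock hp (d hκ.a₁) (d hκ.b₁)) (H.entryDiff_endoBlock hp (d hκ.a₃) (d hκ.b₃))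

/-- Only the fibre components of a horizontal lift vary, and they are linear in y with coefficients
-Γ. -/
theorem sum_matDeriv_adaptedFrame (H : IsLocalMetric h U) (hp : base p ∈ U) (i : Fin n) :
    ∑ a, matDeriv (Pi.single a 1) (adaptedFrame h) p a (Sum.inl i)
      = -(christoffelMatrix h i (base p)).trace := by
  simp only [Fintype.sum_sum_type, matDeriv_adaptedFrame, Matrix.fromBlocks_apply₁₁,
    Matrix.fromBlocks_apply₂₁, Matrix.zero_apply, Finset.sum_const_zero, zero_add, Matrix.neg_apply,
    ← ver_eq (h := h) (p := p), H.matDeriv_connection_ver hp, Finset.sum_neg_distrib]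
  congr 1
  exact Finset.sum_congr rfl fun k _ => H.christoffel_comm _ _ _ _

theorem sum_matDeriv_adaptedFrame_ver (i : Fin n) :
    ∑ a, matDeriv (Pi.single a 1) (adaptedFrame h) p a (Sum.inr i) = 0 := by
  simp only [Fintype.sum_sum_type, matDeriv_adaptedFrame]
  simp

/-- Along δ_j the volume density of G contributes 2 tr Γ_j, and the coordinate divergence of δ_j
contributes -tr Γ_j, so one tr Γ_j survives. The vertical fields have no divergence. -/
theorem formPhi_frame (H : IsLocalMetric h U) (hS : IsLocalStructure κ h U) (hκ : κ.Smooth)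
    (hp : base p ∈ U) (ht : 0 < energy h p) (β : Fin n ⊕ Fin n) :
    ∑ c, formPhi (liftG h κ) (liftJ h κ) c p * adaptedFrame h p c β
      = ∑ j, (christoffelMatrix h j (base p)).trace * frameJ h κ p (Sum.inl j) β
        + ∑ j, volumeDeriv h κ p j * frameJ h κ p (Sum.inr j) β
        + ∑ j, matDeriv (hor h p j) (frameJ h κ) p (Sum.inl j) β
        + ∑ j, matDeriv (ver h p j) (frameJ h κ) p (Sum.inr j) β
        + (∑ j, Matrix.fromBlocks (-(endoBlock h κ.a₂ κ.b₂ p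
              * matDeriv (hor h p j) (connection h) p)) 0
            (endoBlock h κ.a₃ κ.b₃ p * matDeriv (hor h p j) (connection h) p) 0 (Sum.inl j) β)
        + (∑ j, Matrix.fromBlocks (-(endoBlock h κ.a₂ κ.b₂ p
              * christoffelMatrix h j (base p))) 0
            (endoBlock h κ.a₃ κ.b₃ p * christoffelMatrix h j (base p)) 0 (Sum.inr j) β)
        - (1 / 2) * (frameJ h κ p * (frameG h κ p)⁻¹
            * matDeriv (fun a => adaptedFrame h p a β) (frameG h κ) p).trace
        + (endoBlock h κ.a₂ κ.b₂ p
            * matDeriv (fun a => adaptedFrame h p a β) (connection h) p).trace := by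
  have hU : ∀ᶠ q in nhds p, base q ∈ U :=
    (hasFDerivAt_base p).continuousAt.preimage_mem_nhds (H.isOpen.mem_nhds hp)
  -- The factor 2 arises because Γ_j acts on the horizontal and on the vertical block alike.
  have hvol : ∀ j, (1 / 2) * ((frameG h κ p)⁻¹ * matDeriv (hor h p j) (frameG h κ) p).trace
      = 2 * (christoffelMatrix h j (base p)).trace := by
    intro j
    have := trace_mul_inv_mul (hS.isUnit_det_frameG hp) (A := 1) (by simp)
      (Matrix.fromBlocks (christoffelMatrix h j (base p)) 0 0 (christoffelMatrix h j (base p)))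
    rw [Matrix.one_mul, Matrix.one_mul, ← H.matDeriv_frameG_hor hκ hp ht,
      trace_fromBlocks] at this
    rw [this]
    ring
  rw [NaturalLift.formPhi_frame (Filter.Eventually.of_forall (H.liftG_symm κ))
    (hS p hp).2.1.isUnit
    (hU.mono fun q hq => mul_symm_of_antiHermitian (hS q hq).1 (hS q hq).2.2)
    (H.entryDiff_adaptedFrame hp) (H.entryDiff_adaptedCoframe hp) (H.entryDiff_frameJ hκ hp ht)
    (H.entryDiff_frameG hκ hp ht) (adaptedFrame_mul_adaptedCoframe h p) (liftJ_eq κ) (liftG_eq κ)]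
  have hdiv := H.sum_matDeriv_adaptedFrame hp
  have hdiv' := sum_matDeriv_adaptedFrame_ver (h := h) (p := p)
  have hver : ∀ j, (1 / 2) * ((frameG h κ p)⁻¹ * matDeriv (ver h p j) (frameG h κ) p).trace
      = volumeDeriv h κ p j := fun _ => rfl
  simp only [frame_mul_matDeriv_coframe, frameJ_mul_fromBlocks]
  simp only [Fintype.sum_sum_type] at hdiv hdiv' ⊢
  simp only [hdiv, hdiv', trace_fromBlocks, adaptedFrame_inl, adaptedFrame_inr, hvol, hver,
    H.matDeriv_connection_ver hp, Matrix.trace_zero, Matrix.trace_neg, add_zero, zero_mul,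
    Finset.sum_const_zero, neg_mul, Finset.sum_neg_distrib]
  simp only [mul_assoc, ← Finset.mul_sum]
  ring

open Coefficients.Smooth in
/-- The vertical components of `Φ`. -/
theorem formPhi_ver (H : IsLocalMetric h U) (hS : IsLocalStructure κ h U) (hκ : κ.Smooth)
    (hp : base p ∈ U) (ht : 0 < energy h p) (i : Fin n) :
    ∑ c, formPhi (liftG h κ) (liftJ h κ) c p * ver h p i c
      = ∑ j, matDeriv (ver h p j) (endoBlock h κ.a₃ κ.b₃) p j i
        + ∑ j, volumeDeriv h κ p j * endoBlock h κ.a₃ κ.b₃ p j i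
        - (1 / 2) * (frameJ h κ p * (frameG h κ p)⁻¹
            * matDeriv (ver h p i) (frameG h κ) p).trace := by
  have d := fun {f : ℝ → ℝ} (hf : ContDiffOn ℝ ∞ f (Set.Ici 0)) => differentiableAt_of_pos hf ht
  -- The trace sum it produces cancels the surviving tr Γ_j terms, and its tr(EΓ_i) cancels the term
  -- from the vertical derivative of the connection.
  have hc := sum_commutator_christoffel (Γ := fun i => christoffelMatrix h i (base p))
    (fun i j k => H.christoffel_comm _ _ _ _) (endoBlock h κ.a₂ κ.b₂ p) i
  have key := H.formPhi_frame hS hκ hp ht (Sum.inr i)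
  rw [adaptedFrame_inr] at key
  refine key.trans ?_
  simp only [matDeriv_frameJ, H.matDeriv_connection_ver hp,
    H.matDeriv_endoBlock_hor hp (d hκ.a₂) (d hκ.b₂)]
  simp only [frameJ, Matrix.fromBlocks_apply₁₂,
    Matrix.fromBlocks_apply₂₂, Matrix.neg_apply, mul_neg, Finset.sum_neg_distrib, hc,
    Matrix.zero_apply, Finset.sum_const_zero]
  ring

open Coefficients.Smooth in
/-- The horizontal components of `Φ`. -/
theorem formPhi_hor (H : IsLocalMetric h U) (hS : IsLocalStructure κ h U) (hκ : κ.Smooth)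
    (hp : base p ∈ U) (ht : 0 < energy h p) (i : Fin n) :
    ∑ c, formPhi (liftG h κ) (liftJ h κ) c p * hor h p i c
      = ∑ j, matDeriv (ver h p j) (endoBlock h κ.a₁ κ.b₁) p j i
        + ∑ j, volumeDeriv h κ p j * endoBlock h κ.a₁ κ.b₁ p j i
        + ∑ j, ∑ k, endoBlock h κ.a₂ κ.b₂ p j k
          * ∑ l, fibre p l * curvature h k l i j (base p) := by
  have d := fun {f : ℝ → ℝ} (hf : ContDiffOn ℝ ∞ f (Set.Ici 0)) => differentiableAt_of_pos hf ht
  have hΓ : ∀ i j k, christoffelMatrix h i (base p) k j = christoffelMatrix h j (base p) k i :=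
    fun i j k => H.christoffel_comm _ _ _ _
  have hc := sum_commutator_christoffel hΓ (endoBlock h κ.a₄ κ.b₄ p) i
  have h3 : ∑ j, (endoBlock h κ.a₃ κ.b₃ p * christoffelMatrix h j (base p)) j i
      = (endoBlock h κ.a₃ κ.b₃ p * christoffelMatrix h i (base p)).trace := by
    simp only [Matrix.trace, Matrix.diag_apply, Matrix.mul_apply]
    exact Finset.sum_congr rfl fun j _ => Finset.sum_congr rfl fun k _ => by rw [hΓ j i]
  -- The two horizontal derivatives of the connection occur antisymmetrised, which is the curvature;
  -- this is the only place where the geometry of the base survives.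
  have h2 : ∑ j, ∑ k, endoBlock h κ.a₂ κ.b₂ p j k
          * ∑ l, fibre p l * curvature h k l i j (base p)
      = (endoBlock h κ.a₂ κ.b₂ p * matDeriv (hor h p i) (connection h) p).trace
        - ∑ j, (endoBlock h κ.a₂ κ.b₂ p * matDeriv (hor h p j) (connection h) p) j i := by
    simp only [← H.matDeriv_connection_hor_sub hp, Matrix.trace, Matrix.diag_apply,
      Matrix.mul_apply, mul_sub, Finset.sum_sub_distrib]
  have key := H.formPhi_frame hS hκ hp ht (Sum.inl i)
  rw [adaptedFrame_inl] at key
  refine key.trans ?_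
  rw [H.matDeriv_frameG_hor hκ hp ht,
    trace_mul_inv_mul (hS.isUnit_det_frameG hp) (hS.frameG_mul_frameJ hp), h2]
  simp only [matDeriv_frameJ, H.matDeriv_endoBlock_hor hp (d hκ.a₄) (d hκ.b₄)]
  simp only [frameJ, Matrix.fromBlocks_apply₁₁,
    Matrix.fromBlocks_apply₂₁, Matrix.fromBlocks_multiply, Matrix.neg_apply,
    Finset.sum_neg_distrib, hc, Matrix.mul_zero, add_zero, zero_add,
    trace_fromBlocks, h3]
  ring

end IsLocalMetric

end FormPhi

/-! ### Skew-symmetry of the curvature and the Ricci contraction. -/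

section Curvature

variable {n : ℕ} {h : (Fin n → ℝ) → Matrix (Fin n) (Fin n) ℝ} {U : Set (Fin n → ℝ)}
  {p : TangentCoord n} {κ : Coefficients}

namespace IsLocalMetric

theorem contDiffAt_energy (H : IsLocalMetric h U) (hp : base p ∈ U) :
    ContDiffAt ℝ ∞ (energy h) p := by
  have hf : ∀ k, ContDiffAt ℝ ∞ (fun q : TangentCoord n => fibre q k) p :=
    fun k => contDiffAt_apply ℝ ℝ (Sum.inr k) p
  have hb : ContDiffAt ℝ ∞ (base (n := n)) p := contDiffAt_pi.mpr fun k =>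
    contDiffAt_apply ℝ ℝ (Sum.inl k) p
  unfold energy
  exact contDiffAt_const.mul (ContDiffAt.sum fun i _ => ContDiffAt.sum fun k _ =>
    (((H.contDiffAt hp i k).comp p hb).mul (hf i)).mul (hf k))

theorem fderiv_energy_of_base_eq_zero (H : IsLocalMetric h U) (hp : base p ∈ U)
    {w : TangentCoord n} (hw : base w = 0) :
    fderiv ℝ (energy h) p w = ∑ k, lowered h p k * fibre w k := by
  rw [H.fderiv_energy hp]
  simp only [H.fderiv_lowered hp, hw, matDeriv_zero, Matrix.zero_apply, mul_zero,
    Finset.sum_const_zero, add_zero, Finset.sum_add_distrib]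
  have : ∑ k, (∑ l, fibre w l * h (base p) l k) * fibre p k = ∑ k, lowered h p k * fibre w k := by
    simp only [H.lowered_eq, Finset.sum_mul]
    rw [Finset.sum_comm]
    exact Finset.sum_congr rfl fun k _ => Finset.sum_congr rfl fun l _ => by ring
  rw [this]
  ring

/-- Differentiate dt(δ_j) = 0 along v: the Hessian term is -dt(D_v δ_j), and D_v δ_j is vertical
with components minus the derivative of the connection. -/
theorem fderiv_fderiv_energy_hor (H : IsLocalMetric h U) (hp : base p ∈ U) (v : TangentCoord n)
    (j : Fin n) : fderiv ℝ (fderiv ℝ (energy h)) p v (hor h p j)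
      = ∑ k, lowered h p k * matDeriv v (connection h) p k j := by
  have hU : ∀ᶠ q in nhds p, base q ∈ U :=
    (hasFDerivAt_base p).continuousAt.preimage_mem_nhds (H.isOpen.mem_nhds hp)
  have hz : (fun q => fderiv ℝ (energy h) q (hor h q j)) =ᶠ[nhds p] fun _ => 0 :=
    hU.mono fun q hq => H.fderiv_energy_hor hq j
  have hE : DifferentiableAt ℝ (fderiv ℝ (energy h)) p :=
    ((H.contDiffAt_energy hp).fderiv_right (m := ∞) (by simp)).differentiableAt (by simp)
  have hd : ∀ a, DifferentiableAt ℝ (fun q => hor h q j a) p :=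
    fun a => H.entryDiff_adaptedFrame hp a (Sum.inl j)
  have hX : DifferentiableAt ℝ (fun q => hor h q j) p := differentiableAt_pi.mpr hd
  have hv : fderiv ℝ (fun q => hor h q j) p v
      = fun a => matDeriv v (adaptedFrame h) p a (Sum.inl j) := by
    rw [fderiv_pi hd]
    rfl
  have key : fderiv ℝ (fun q => fderiv ℝ (energy h) q (hor h q j)) p v = 0 := by
    rw [hz.fderiv_eq]
    simp
  rw [fderiv_clm_apply hE hX] at key
  simp only [_root_.add_apply, ContinuousLinearMap.comp_apply, ContinuousLinearMap.flip_apply,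
    hv] at key
  rw [H.fderiv_energy_of_base_eq_zero hp (by ext i; simp [base, matDeriv_adaptedFrame])] at key
  simp only [fibre, matDeriv_adaptedFrame, Matrix.fromBlocks_apply₂₁, Matrix.neg_apply, mul_neg,
    Finset.sum_neg_distrib] at key
  linarith

/-- The curvature is skew-symmetric with respect to the metric. -/
theorem sum_lowered_curvature (H : IsLocalMetric h U) (hp : base p ∈ U) (i j : Fin n) :
    ∑ k, lowered h p k * ∑ l, fibre p l * curvature h k l i j (base p) = 0 := by
  -- Symmetry of the Hessian of the energy on two horizontal vectors is exactly the vanishing of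
  -- g(R(∂_i, ∂_j)y, y).
  have hs := ((H.contDiffAt_energy hp).isSymmSndFDerivAt
    (by simpa using WithTop.coe_le_coe.mpr (le_top : (2 : ℕ∞) ≤ ⊤))) (hor h p i) (hor h p j)
  rw [H.fderiv_fderiv_energy_hor hp, H.fderiv_fderiv_energy_hor hp] at hs
  simp only [← H.matDeriv_connection_hor_sub hp, mul_sub, Finset.sum_sub_distrib, hs, sub_self]

end IsLocalMetric

theorem curvature_antisymm (k l i j : Fin n) (x : Fin n → ℝ) :
    curvature h k l i j x = -curvature h k l j i x := by
  simp only [curvature, Finset.sum_sub_distrib]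
  ring

/-- The b-part pairs R(∂_i, ∂_j)y with y and vanishes by skew-symmetry. The a-part is a trace over
the wrong one of the last two indices, whence the sign. -/
theorem sum_endoBlock_curvature (H : IsLocalMetric h U) (hp : base p ∈ U) (a b : ℝ → ℝ)
    (i : Fin n) :
    ∑ j, ∑ k, endoBlock h a b p j k * ∑ l, fibre p l * curvature h k l i j (base p)
      = -(a (energy h p) * ∑ l, fibre p l * ricci h l i (base p)) := by
  have h1 : ∀ j, ∑ k, endoBlock h a b p j k * ∑ l, fibre p l * curvature h k l i j (base p)
      = -(a (energy h p) * ∑ l, fibre p l * curvature h j l j i (base p)) := by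
    intro j
    have h2 := H.sum_lowered_curvature hp i j
    simp only [endoBlock, Matrix.of_apply, add_mul, Finset.sum_add_distrib]
    simp only [mul_assoc, ← Finset.mul_sum, h2, Matrix.one_apply, ite_mul, one_mul, zero_mul,
      Finset.sum_ite_eq, Finset.mem_univ, if_true]
    simp only [curvature_antisymm j _ i j, mul_neg, Finset.sum_neg_distrib]
    ring
  rw [Finset.sum_congr rfl fun j _ => h1 j]
  simp only [ricci, Finset.mul_sum, Finset.sum_neg_distrib]
  rw [Finset.sum_comm]

end Curvature

/-! ### Products and traces of natural blocks. -/

section Trace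

variable {n : ℕ} {h : (Fin n → ℝ) → Matrix (Fin n) (Fin n) ℝ} {U : Set (Fin n → ℝ)}
  {p : TangentCoord n} {κ : Coefficients}

/-- The bivector `α g⁻¹ + β y ⊗ y`. -/
def bivectorBlock (h : (Fin n → ℝ) → Matrix (Fin n) (Fin n) ℝ) (α β : ℝ) (p : TangentCoord n) :
    Matrix (Fin n) (Fin n) ℝ :=
  α • (h (base p))⁻¹ + β • Matrix.vecMulVec (fibre p) (fibre p)

theorem endoBlock_eq (a b : ℝ → ℝ) : endoBlock h a b p
    = a (energy h p) • (1 : Matrix (Fin n) (Fin n) ℝ)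
      + b (energy h p) • Matrix.vecMulVec (fibre p) (lowered h p) := by
  ext i j
  simp [endoBlock, Matrix.vecMulVec_apply, mul_assoc]

theorem formBlock_eq (c d : ℝ → ℝ) : formBlock h c d p = c (energy h p) • h (base p)
      + d (energy h p) • Matrix.vecMulVec (lowered h p) (lowered h p) := by
  ext i j
  simp [formBlock, Matrix.vecMulVec_apply, mul_assoc]

theorem lowered_dotProduct_fibre : lowered h p ⬝ᵥ fibre p = 2 * energy h p := by
  rw [energy_eq, dotProduct]
  ring

theorem bivectorBlock_add (α β α' β' : ℝ) :
    bivectorBlock h α β p + bivectorBlock h α' β' p = bivectorBlock h (α + α') (β + β') p := by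
  simp only [bivectorBlock, add_smul]
  abel

theorem bivectorBlock_neg (α β : ℝ) : -bivectorBlock h α β p = bivectorBlock h (-α) (-β) p := by
  simp only [bivectorBlock, neg_smul]
  abel

theorem endoBlock_mul_bivectorBlock (H : IsLocalMetric h U) (hp : base p ∈ U) (a b : ℝ → ℝ)
    (α β : ℝ) : endoBlock h a b p * bivectorBlock h α β p
      = bivectorBlock h (a (energy h p) * α)
        (a (energy h p) * β + b (energy h p) * α + 2 * energy h p * b (energy h p) * β) p := by
  have h1 : lowered h p ᵥ* (h (base p))⁻¹ = fibre p := by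
    have : lowered h p = fibre p ᵥ* h (base p) := rfl
    rw [this, Matrix.vecMul_vecMul, Matrix.mul_nonsing_inv _ (H.isUnit_det hp), Matrix.vecMul_one]
  rw [endoBlock_eq, bivectorBlock, bivectorBlock]
  simp only [Matrix.add_mul, Matrix.mul_add, Matrix.smul_mul, Matrix.mul_smul, Matrix.one_mul,
    Matrix.vecMulVec_mul, h1, Matrix.vecMul_vecMulVec, lowered_dotProduct_fibre,
    Matrix.vecMulVec_smul]
  module

theorem formBlock_mul_bivectorBlock (H : IsLocalMetric h U) (hp : base p ∈ U) (c d : ℝ → ℝ)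
    (α β : ℝ) : formBlock h c d p * bivectorBlock h α β p
      = (c (energy h p) * α) • (1 : Matrix (Fin n) (Fin n) ℝ)
        + (c (energy h p) * β + d (energy h p) * (α + 2 * energy h p * β)) •
          Matrix.vecMulVec (lowered h p) (fibre p) := by
  have h1 : lowered h p ᵥ* (h (base p))⁻¹ = fibre p := by
    have : lowered h p = fibre p ᵥ* h (base p) := rfl
    rw [this, Matrix.vecMul_vecMul, Matrix.mul_nonsing_inv _ (H.isUnit_det hp), Matrix.vecMul_one]
  have h2 : h (base p) *ᵥ fibre p = lowered h p := by
    ext i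
    exact (H.lowered_eq i).symm
  have h3 : h (base p) * Matrix.vecMulVec (fibre p) (fibre p)
      = Matrix.vecMulVec (lowered h p) (fibre p) := by rw [Matrix.mul_vecMulVec, h2]
  rw [formBlock_eq, bivectorBlock]
  simp only [Matrix.add_mul, Matrix.mul_add, Matrix.smul_mul, Matrix.mul_smul,
    Matrix.mul_nonsing_inv _ (H.isUnit_det hp), h3,
    Matrix.vecMulVec_mul, h1, Matrix.vecMul_vecMulVec, lowered_dotProduct_fibre,
    Matrix.vecMulVec_smul]
  module

/-- The trace of `(α g⁻¹ + β y ⊗ y) S`, where `S` is the derivative of `c g + d y♭ ⊗ y♭` along a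
vertical lift, up to the factor `g(∂_i, y)`. -/
def traceCoeff (n t α β c' d d' : ℝ) : ℝ :=
  α * (n * c' + 2 * t * d' + 2 * d) + β * (2 * t * c' + 4 * t ^ 2 * d' + 4 * t * d)

/-- The dimension enters only through tr(g⁻¹g) = n, multiplied by α c'. All other terms are
evaluations on y, so the d-coefficients never multiply n. -/
theorem trace_bivectorBlock_mul (H : IsLocalMetric h U) (hp : base p ∈ U) {c d : ℝ → ℝ}
    (hc : DifferentiableAt ℝ c (energy h p)) (hd : DifferentiableAt ℝ d (energy h p))
    (α β : ℝ) (i : Fin n) :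
    (bivectorBlock h α β p * matDeriv (ver h p i) (formBlock h c d) p).trace
      = lowered h p i * traceCoeff n (energy h p) α β (deriv c (energy h p)) (d (energy h p))
        (deriv d (energy h p)) := by
  set t := energy h p with ht
  set l := lowered h p with hl
  set y := fibre p with hy
  set w : Fin n → ℝ := fun k => h (base p) i k with hw
  have e : matDeriv (ver h p i) (formBlock h c d) p
      = (deriv c t * l i) • h (base p) + (deriv d t * l i) • Matrix.vecMulVec l l
        + d t • (Matrix.vecMulVec w l + Matrix.vecMulVec l w) := by
    ext k j
    rw [H.matDeriv_formBlock hp hc hd, H.fderiv_energy_ver hp, H.fderiv_lowered_ver hp,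
      H.fderiv_lowered_ver hp, base_ver, matDeriv_zero]
    simp only [Matrix.add_apply, Matrix.smul_apply, Matrix.vecMulVec_apply, smul_eq_mul,
      Matrix.zero_apply]
    ring
  have hl1 : (h (base p))⁻¹ *ᵥ l = y := by
    have : l = h (base p) *ᵥ y := funext fun k => H.lowered_eq k
    rw [this, Matrix.mulVec_mulVec, Matrix.nonsing_inv_mul _ (H.isUnit_det hp), Matrix.one_mulVec]
  have hw1 : (h (base p))⁻¹ *ᵥ w = Pi.single i 1 := by
    have : w = h (base p) *ᵥ Pi.single i 1 := by
      ext k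
      simp [hw, H.apply_comm _ i k]
    rw [this, Matrix.mulVec_mulVec, Matrix.nonsing_inv_mul _ (H.isUnit_det hp), Matrix.one_mulVec]
  have hly : y ⬝ᵥ l = 2 * t := by rw [dotProduct_comm]; exact lowered_dotProduct_fibre
  have hwy : y ⬝ᵥ w = l i := by
    rw [dotProduct_comm]
    exact (H.lowered_eq i).symm
  have tA : ∀ u v, ((h (base p))⁻¹ * Matrix.vecMulVec u v).trace = ((h (base p))⁻¹ *ᵥ u) ⬝ᵥ v := by
    intro u v
    rw [Matrix.mul_vecMulVec, Matrix.trace_vecMulVec]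
  have tB : ∀ u v, (Matrix.vecMulVec y y * Matrix.vecMulVec u v).trace = (y ⬝ᵥ u) * (y ⬝ᵥ v) := by
    intro u v
    rw [Matrix.vecMulVec_mul_vecMulVec, Matrix.trace_vecMulVec, dotProduct_smul, smul_eq_mul]
  have hyh : (Matrix.vecMulVec y y * h (base p)).trace = 2 * t := by
    rw [Matrix.vecMulVec_mul, Matrix.trace_vecMulVec, ← hly]
    rfl
  have hb : bivectorBlock h α β p = α • (h (base p))⁻¹ + β • Matrix.vecMulVec y y := rfl
  rw [e, hb]
  simp only [Matrix.add_mul, Matrix.mul_add, Matrix.smul_mul, Matrix.mul_smul, Matrix.trace_add,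
    Matrix.trace_smul, Matrix.nonsing_inv_mul _ (H.isUnit_det hp), tA, tB, hyh, hl1, hw1, hly, hwy,
    Matrix.trace_one, Fintype.card_fin, smul_eq_mul, single_dotProduct, smul_add, traceCoeff]
  ring

end Trace

/-! ### Φ = 0 as scalar equations in the energy density. -/

section Scalar

variable {n : ℕ} {h : (Fin n → ℝ) → Matrix (Fin n) (Fin n) ℝ} {U : Set (Fin n → ℝ)}
  {p : TangentCoord n} {κ : Coefficients}

/-- The coefficients of the inverse of `G` at energy density `t`: the blocks of the inverse are
`α g⁻¹ + β y ⊗ y`. -/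
structure InverseMetric (κ : Coefficients) (t : ℝ) where
  (α₁ α₂ α₃ β₁ β₂ β₃ : ℝ)
  eq₁ : κ.c₁ t * α₁ + κ.c₃ t * α₃ = 1
  eq₂ : κ.c₁ t * α₃ + κ.c₃ t * α₂ = 0
  eq₃ : κ.c₃ t * α₁ + κ.c₂ t * α₃ = 0
  eq₄ : κ.c₃ t * α₃ + κ.c₂ t * α₂ = 1
  eq₅ : κ.c₁ t * β₁ + κ.d₁ t * (α₁ + 2 * t * β₁) + (κ.c₃ t * β₃ + κ.d₃ t * (α₃ + 2 * t * β₃)) = 0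
  eq₆ : κ.c₁ t * β₃ + κ.d₁ t * (α₃ + 2 * t * β₃) + (κ.c₃ t * β₂ + κ.d₃ t * (α₂ + 2 * t * β₂)) = 0
  eq₇ : κ.c₃ t * β₁ + κ.d₃ t * (α₁ + 2 * t * β₁) + (κ.c₂ t * β₃ + κ.d₂ t * (α₃ + 2 * t * β₃)) = 0
  eq₈ : κ.c₃ t * β₃ + κ.d₃ t * (α₃ + 2 * t * β₃) + (κ.c₂ t * β₂ + κ.d₂ t * (α₂ + 2 * t * β₂)) = 0

/-- G splits into a 2 × 2 Gram matrix with entries c_i on directions orthogonal to y and one with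
entries c_i + 2t d_i along y. The α_i are the entries of the first inverse and α_i + 2tβ_i those of
the second, so solving for β_i divides by 2t. -/
theorem exists_inverseMetric {t : ℝ} (ht : t ≠ 0)
    (h1 : κ.c₁ t * κ.c₂ t - κ.c₃ t ^ 2 ≠ 0)
    (h2 : (κ.c₁ t + 2 * t * κ.d₁ t) * (κ.c₂ t + 2 * t * κ.d₂ t) - (κ.c₃ t + 2 * t * κ.d₃ t) ^ 2 ≠ 0) :
    Nonempty (InverseMetric κ t) := by
  set D := κ.c₁ t * κ.c₂ t - κ.c₃ t ^ 2 with hD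
  set E := (κ.c₁ t + 2 * t * κ.d₁ t) * (κ.c₂ t + 2 * t * κ.d₂ t) - (κ.c₃ t + 2 * t * κ.d₃ t) ^ 2
    with hE
  refine ⟨⟨κ.c₂ t / D, κ.c₁ t / D, -κ.c₃ t / D,
    ((κ.c₂ t + 2 * t * κ.d₂ t) / E - κ.c₂ t / D) / (2 * t),
    ((κ.c₁ t + 2 * t * κ.d₁ t) / E - κ.c₁ t / D) / (2 * t),
    (-(κ.c₃ t + 2 * t * κ.d₃ t) / E - -κ.c₃ t / D) / (2 * t), ?_, ?_, ?_, ?_, ?_, ?_, ?_, ?_⟩⟩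
  · field_simp; rw [hD]; ring
  · field_simp; ring
  · field_simp; ring
  · field_simp; rw [hD]; ring
  · field_simp; rw [hD, hE]; ring
  · field_simp; rw [hD, hE]; ring
  · field_simp; rw [hD, hE]; ring
  · field_simp; rw [hD, hE]; ring

theorem InverseMetric.inv_frameG (H : IsLocalMetric h U) (hp : base p ∈ U)
    (I : InverseMetric κ (energy h p)) : (frameG h κ p)⁻¹
      = Matrix.fromBlocks (bivectorBlock h I.α₁ I.β₁ p) (bivectorBlock h I.α₃ I.β₃ p)
        (bivectorBlock h I.α₃ I.β₃ p) (bivectorBlock h I.α₂ I.β₂ p) := by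
  refine Matrix.inv_eq_right_inv ?_
  have add4 : ∀ (a b c d : ℝ) (A B : Matrix (Fin n) (Fin n) ℝ),
      a • A + b • B + (c • A + d • B) = (a + c) • A + (b + d) • B := fun a b c d A B => by module
  rw [frameG, Matrix.fromBlocks_multiply]
  simp only [formBlock_mul_bivectorBlock H hp, add4, I.eq₁, I.eq₂, I.eq₃, I.eq₄, I.eq₅, I.eq₆,
    I.eq₇, I.eq₈, zero_smul, one_smul, add_zero, Matrix.fromBlocks_one]

/-- The logarithmic derivative of the volume density of `G`. -/
def InverseMetric.volumeCoeff {t : ℝ} (I : InverseMetric κ t) (n : ℝ) : ℝ :=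
  (1 / 2) * (traceCoeff n t I.α₁ I.β₁ (deriv κ.c₁ t) (κ.d₁ t) (deriv κ.d₁ t)
    + 2 * traceCoeff n t I.α₃ I.β₃ (deriv κ.c₃ t) (κ.d₃ t) (deriv κ.d₃ t)
    + traceCoeff n t I.α₂ I.β₂ (deriv κ.c₂ t) (κ.d₂ t) (deriv κ.d₂ t))

open Coefficients.Smooth in
theorem volumeDeriv_eq (H : IsLocalMetric h U) (hκ : κ.Smooth) (hp : base p ∈ U)
    (ht : 0 < energy h p) (I : InverseMetric κ (energy h p)) (i : Fin n) :
    volumeDeriv h κ p i = lowered h p i * I.volumeCoeff n := by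
  have d := fun {f : ℝ → ℝ} (hf : ContDiffOn ℝ ∞ f (Set.Ici 0)) => differentiableAt_of_pos hf ht
  rw [volumeDeriv, matDeriv_frameG, I.inv_frameG H hp, Matrix.fromBlocks_multiply,
    trace_fromBlocks, Matrix.trace_add, Matrix.trace_add,
    trace_bivectorBlock_mul H hp (d hκ.c₁) (d hκ.d₁),
    trace_bivectorBlock_mul H hp (d hκ.c₂) (d hκ.d₂),
    trace_bivectorBlock_mul H hp (d hκ.c₃) (d hκ.d₃), InverseMetric.volumeCoeff]
  ring

/-- In the factor n + 1, the n is the divergence of the field y and the 1 comes from the derivative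
of y♭ in the direction y. -/
theorem sum_matDeriv_endoBlock_ver (H : IsLocalMetric h U) (hp : base p ∈ U) {a b : ℝ → ℝ}
    (ha : DifferentiableAt ℝ a (energy h p)) (hb : DifferentiableAt ℝ b (energy h p)) (i : Fin n) :
    ∑ j, matDeriv (ver h p j) (endoBlock h a b) p j i
      = lowered h p i * (deriv a (energy h p) + 2 * energy h p * deriv b (energy h p)
        + (n + 1) * b (energy h p)) := by
  have h1 : ∑ j, lowered h p j * fibre p j = 2 * energy h p := lowered_dotProduct_fibre
  have h2 : ∀ j, matDeriv (ver h p j) (endoBlock h a b) p j i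
      = deriv a (energy h p) * (if j = i then lowered h p j else 0)
        + deriv b (energy h p) * lowered h p i * (lowered h p j * fibre p j)
        + b (energy h p) * (lowered h p i + h (base p) i j * fibre p j) := by
    intro j
    rw [H.matDeriv_endoBlock hp ha hb, H.fderiv_energy_ver hp, H.fderiv_lowered_ver hp, fibre_ver,
      Pi.single_eq_same, Matrix.one_apply, H.apply_comm _ j i]
    split_ifs <;> ring
  simp only [h2, Finset.sum_add_distrib, ← Finset.mul_sum, h1, ← H.lowered_eq,
    Finset.sum_ite_eq', Finset.mem_univ, if_true, Finset.sum_const, Finset.card_univ,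
    Fintype.card_fin, nsmul_eq_mul]
  ring

theorem sum_mul_endoBlock {a b : ℝ → ℝ} (c : ℝ) (i : Fin n) :
    ∑ j, lowered h p j * c * endoBlock h a b p j i
      = lowered h p i * (c * (a (energy h p) + 2 * energy h p * b (energy h p))) := by
  have h1 : ∑ j, lowered h p j * fibre p j = 2 * energy h p := lowered_dotProduct_fibre
  have h2 : ∀ j, lowered h p j * c * endoBlock h a b p j i
      = c * a (energy h p) * (if j = i then lowered h p j else 0)
        + c * b (energy h p) * lowered h p i * (lowered h p j * fibre p j) := by
    intro j
    rw [endoBlock, Matrix.of_apply, Matrix.one_apply]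
    split_ifs <;> ring
  simp only [h2, Finset.sum_add_distrib, ← Finset.mul_sum, h1, Finset.sum_ite_eq', Finset.mem_univ,
    if_true]
  ring

open Coefficients.Smooth in
/-- Vanishing of the horizontal components of `Φ` determines the Ricci tensor. -/
theorem ricci_of_formPhi_eq_zero (H : IsLocalMetric h U) (hS : IsLocalStructure κ h U)
    (hκ : κ.Smooth) (hp : base p ∈ U) {t : ℝ} (het : energy h p = t) (ht : 0 < t)
    (hΦ : ∀ c, formPhi (liftG h κ) (liftJ h κ) c p = 0) (I : InverseMetric κ t)
    (i : Fin n) :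
    κ.a₂ t * ∑ l, fibre p l * ricci h l i (base p)
      = lowered h p i * (deriv κ.a₁ t + 2 * t * deriv κ.b₁ t
        + (n + 1) * κ.b₁ t
        + I.volumeCoeff n * (κ.a₁ t + 2 * t * κ.b₁ t)) := by
  subst het
  have d := fun {f : ℝ → ℝ} (hf : ContDiffOn ℝ ∞ f (Set.Ici 0)) => differentiableAt_of_pos hf ht
  have key := H.formPhi_hor hS hκ hp ht i
  simp only [hΦ, zero_mul, Finset.sum_const_zero, volumeDeriv_eq H hκ hp ht I,
    sum_matDeriv_endoBlock_ver H hp (d hκ.a₁) (d hκ.b₁), sum_mul_endoBlock,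
    sum_endoBlock_curvature H hp] at key
  linarith

/-- The coefficient of `α` in the product of the blocks `a + b y ⊗ y♭` and `α g⁻¹ + β y ⊗ y` is
`a α`; this is the coefficient of `y ⊗ y`. -/
def bivectorCoeff (t a b α β : ℝ) : ℝ := a * β + b * α + 2 * t * b * β

/-- The trace of `J` against the logarithmic derivative of `G`. -/
def InverseMetric.twistedCoeff {t : ℝ} (I : InverseMetric κ t) (n : ℝ) : ℝ :=
  traceCoeff n t (κ.a₄ t * I.α₁ - κ.a₂ t * I.α₃)
      (bivectorCoeff t (κ.a₄ t) (κ.b₄ t) I.α₁ I.β₁ - bivectorCoeff t (κ.a₂ t) (κ.b₂ t) I.α₃ I.β₃)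
      (deriv κ.c₁ t) (κ.d₁ t) (deriv κ.d₁ t)
    + traceCoeff n t (κ.a₄ t * I.α₃ - κ.a₂ t * I.α₂)
      (bivectorCoeff t (κ.a₄ t) (κ.b₄ t) I.α₃ I.β₃ - bivectorCoeff t (κ.a₂ t) (κ.b₂ t) I.α₂ I.β₂)
      (deriv κ.c₃ t) (κ.d₃ t) (deriv κ.d₃ t)
    + traceCoeff n t (κ.a₁ t * I.α₁ + κ.a₃ t * I.α₃)
      (bivectorCoeff t (κ.a₁ t) (κ.b₁ t) I.α₁ I.β₁ + bivectorCoeff t (κ.a₃ t) (κ.b₃ t) I.α₃ I.β₃)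
      (deriv κ.c₃ t) (κ.d₃ t) (deriv κ.d₃ t)
    + traceCoeff n t (κ.a₁ t * I.α₃ + κ.a₃ t * I.α₂)
      (bivectorCoeff t (κ.a₁ t) (κ.b₁ t) I.α₃ I.β₃ + bivectorCoeff t (κ.a₃ t) (κ.b₃ t) I.α₂ I.β₂)
      (deriv κ.c₂ t) (κ.d₂ t) (deriv κ.d₂ t)

open Coefficients.Smooth in
/-- Vanishing of the vertical components of `Φ`. -/
theorem scalar_of_formPhi_eq_zero (H : IsLocalMetric h U) (hS : IsLocalStructure κ h U)
    (hκ : κ.Smooth) (hp : base p ∈ U) {t : ℝ} (het : energy h p = t) (ht : 0 < t)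
    (hΦ : ∀ c, formPhi (liftG h κ) (liftJ h κ) c p = 0) (I : InverseMetric κ t) :
    deriv κ.a₃ t + 2 * t * deriv κ.b₃ t
        + (n + 1) * κ.b₃ t
        + I.volumeCoeff n * (κ.a₃ t + 2 * t * κ.b₃ t)
        - (1 / 2) * I.twistedCoeff n = 0 := by
  subst het
  have d := fun {f : ℝ → ℝ} (hf : ContDiffOn ℝ ∞ f (Set.Ici 0)) => differentiableAt_of_pos hf ht
  -- Every vertical component of Φ is the same scalar times a component of y♭, so one nonzero
  -- component suffices.
  obtain ⟨i, hi⟩ : ∃ i, lowered h p i ≠ 0 := by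
    by_contra! hl
    simp [energy_eq, hl] at ht
  have htr : (frameJ h κ p * (frameG h κ p)⁻¹ * matDeriv (ver h p i) (frameG h κ) p).trace
      = lowered h p i * I.twistedCoeff n := by
    rw [matDeriv_frameG, I.inv_frameG H hp, frameJ, Matrix.fromBlocks_multiply]
    simp only [Matrix.neg_mul, endoBlock_mul_bivectorBlock H hp, bivectorBlock_neg,
      bivectorBlock_add]
    rw [Matrix.fromBlocks_multiply, trace_fromBlocks, Matrix.trace_add, Matrix.trace_add]
    simp only [trace_bivectorBlock_mul H hp (d hκ.c₁) (d hκ.d₁),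
      trace_bivectorBlock_mul H hp (d hκ.c₂) (d hκ.d₂),
      trace_bivectorBlock_mul H hp (d hκ.c₃) (d hκ.d₃), InverseMetric.twistedCoeff, bivectorCoeff,
      ← sub_eq_add_neg]
    ring
  have key := H.formPhi_ver hS hκ hp ht i
  simp only [hΦ, zero_mul, Finset.sum_const_zero, volumeDeriv_eq H hκ hp ht I,
    sum_matDeriv_endoBlock_ver H hp (d hκ.a₃) (d hκ.b₃), sum_mul_endoBlock, htr] at key
  refine mul_left_cancel₀ hi ?_
  linarith

end Scalar

/-! ### Algebraic relations at one tangent vector, and the resulting Ricci tensor. -/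

section Pointwise

variable {n : ℕ} {h : (Fin n → ℝ) → Matrix (Fin n) (Fin n) ℝ} {U : Set (Fin n → ℝ)}
  {p : TangentCoord n} {κ : Coefficients}

theorem endoBlock_mulVec {w : Fin n → ℝ} (hw : lowered h p ⬝ᵥ w = 0) (a b : ℝ → ℝ) :
    endoBlock h a b p *ᵥ w = a (energy h p) • w := by
  rw [endoBlock_eq, Matrix.add_mulVec, Matrix.smul_mulVec, Matrix.smul_mulVec, Matrix.one_mulVec,
    Matrix.vecMulVec_mulVec, hw]
  simp

theorem endoBlock_transpose_mulVec {u : Fin n → ℝ} (hu : fibre p ⬝ᵥ u = 0) (a b : ℝ → ℝ) :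
    (endoBlock h a b p)ᵀ *ᵥ u = a (energy h p) • u := by
  rw [endoBlock_eq, Matrix.transpose_add, Matrix.transpose_smul, Matrix.transpose_smul,
    Matrix.transpose_one, Matrix.transpose_vecMulVec, Matrix.add_mulVec, Matrix.smul_mulVec,
    Matrix.smul_mulVec, Matrix.one_mulVec, Matrix.vecMulVec_mulVec, hu]
  simp

theorem formBlock_mulVec {w : Fin n → ℝ} (hw : lowered h p ⬝ᵥ w = 0) (c d : ℝ → ℝ) :
    formBlock h c d p *ᵥ w = c (energy h p) • (h (base p) *ᵥ w) := by
  rw [formBlock_eq, Matrix.add_mulVec, Matrix.smul_mulVec, Matrix.smul_mulVec,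
    Matrix.vecMulVec_mulVec, hw]
  simp

theorem formBlock_mulVec_fibre (H : IsLocalMetric h U) (c d : ℝ → ℝ) :
    formBlock h c d p *ᵥ fibre p
      = (c (energy h p) + 2 * energy h p * d (energy h p)) • lowered h p := by
  have h2 : h (base p) *ᵥ fibre p = lowered h p := by
    ext i
    exact (H.lowered_eq i).symm
  rw [formBlock_eq, Matrix.add_mulVec, Matrix.smul_mulVec, Matrix.smul_mulVec,
    Matrix.vecMulVec_mulVec, lowered_dotProduct_fibre, h2]
  ext i
  simp
  ring

/-- A kernel vector (r, s) of the 2 × 2 matrix would give the kernel vector (r w, s w) of the block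
matrix. -/
theorem gram_ne_zero_of_det_ne_zero {F₁ F₂ F₃ : Matrix (Fin n) (Fin n) ℝ}
    (hdet : IsUnit (Matrix.fromBlocks F₁ F₃ F₃ F₂).det) {w u : Fin n → ℝ} (hw : w ≠ 0)
    {k₁ k₂ k₃ : ℝ} (h1 : F₁ *ᵥ w = k₁ • u) (h2 : F₂ *ᵥ w = k₂ • u) (h3 : F₃ *ᵥ w = k₃ • u) :
    k₁ * k₂ - k₃ ^ 2 ≠ 0 := by
  intro h0
  have key : ∀ r s : ℝ, k₁ * r + k₃ * s = 0 → k₃ * r + k₂ * s = 0 → r = 0 ∧ s = 0 := by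
    intro r s e1 e2
    have hz : Matrix.fromBlocks F₁ F₃ F₃ F₂ *ᵥ Sum.elim (r • w) (s • w) = 0 := by
      rw [Matrix.fromBlocks_mulVec]
      ext (i | i)
      · simp only [Sum.elim_comp_inl, Sum.elim_comp_inr, Matrix.mulVec_smul, h1, h3, smul_smul,
          ← add_smul, Sum.elim_inl, Pi.zero_apply]
        rw [mul_comm r, mul_comm s, e1, zero_smul, Pi.zero_apply]
      · simp only [Sum.elim_comp_inl, Sum.elim_comp_inr, Matrix.mulVec_smul, h2, h3, smul_smul,
          ← add_smul, Sum.elim_inr, Pi.zero_apply]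
        rw [mul_comm r, mul_comm s, e2, zero_smul, Pi.zero_apply]
    have hz' : Sum.elim (r • w) (s • w) = 0 := by
      have := congrArg (fun v => (Matrix.fromBlocks F₁ F₃ F₃ F₂)⁻¹ *ᵥ v) hz
      simpa only [Matrix.mulVec_mulVec, Matrix.nonsing_inv_mul _ hdet, Matrix.one_mulVec,
        Matrix.mulVec_zero] using this
    have hr : r • w = 0 := funext fun i => congrFun hz' (Sum.inl i)
    have hs : s • w = 0 := funext fun i => congrFun hz' (Sum.inr i)
    exact ⟨(smul_eq_zero.mp hr).resolve_right hw, (smul_eq_zero.mp hs).resolve_right hw⟩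
  -- If the determinant vanishes, the columns of the adjugate lie in the kernel, so all entries are
  -- zero; then (1, 0) lies in the kernel too.
  obtain ⟨-, hk1⟩ := key (-k₃) k₁ (by ring) (by linarith)
  obtain ⟨hk2, hk3⟩ := key k₂ (-k₃) (by linarith) (by ring)
  have hk3' : k₃ = 0 := by linarith
  exact one_ne_zero (key 1 0 (by simp [hk1]) (by simp [hk3'])).1

/-- The algebraic relations need dimension at least 2 precisely for such a vector. -/
theorem exists_ne_zero_dotProduct_eq_zero (hn : 2 ≤ n) (l : Fin n → ℝ) :
    ∃ w : Fin n → ℝ, w ≠ 0 ∧ l ⬝ᵥ w = 0 := by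
  let i : Fin n := ⟨0, by omega⟩
  let j : Fin n := ⟨1, by omega⟩
  have hij : j ≠ i := by simp [i, j]
  by_cases hi : l i = 0
  · exact ⟨Pi.single i 1, by simp, by simp [hi]⟩
  · refine ⟨l j • Pi.single i 1 - l i • Pi.single j 1, fun h0 => hi ?_, ?_⟩
    · simpa [hij] using congrFun h0 j
    · simp [dotProduct_sub]
      ring

/-- In dimension at least two, the algebraic relations between the coefficients. -/
theorem coefficient_relations (H : IsLocalMetric h U) (hS : IsLocalStructure κ h U) (hn : 2 ≤ n)
    (hp : base p ∈ U) {t : ℝ} (het : energy h p = t) :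
    κ.a₄ t = -κ.a₃ t ∧ κ.a₁ t * κ.a₂ t = 1 + κ.a₃ t ^ 2 ∧
    κ.a₁ t * κ.c₂ t = 2 * κ.a₃ t * κ.c₃ t - κ.a₂ t * κ.c₁ t ∧
    κ.c₁ t * κ.c₂ t - κ.c₃ t ^ 2 ≠ 0 := by
  subst het
  -- For w orthogonal to y, J preserves the span of w^H and w^V and acts there by the a_i alone.
  -- Likewise G maps it through the c_i alone, so the matrix identities become 2 × 2 ones.
  obtain ⟨w, hw, hlw⟩ := exists_ne_zero_dotProduct_eq_zero hn (lowered h p)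
  set u := h (base p) *ᵥ w with hu
  have hu0 : u ≠ 0 := by
    intro h0
    refine hw ?_
    rw [← Matrix.one_mulVec w, ← Matrix.nonsing_inv_mul _ (H.isUnit_det hp),
      ← Matrix.mulVec_mulVec, ← hu, h0, Matrix.mulVec_zero]
  have hyu : fibre p ⬝ᵥ u = 0 := by
    rw [hu, Matrix.dotProduct_mulVec]
    exact hlw
  obtain ⟨i, hi⟩ := Function.ne_iff.mp hw
  obtain ⟨j, hj⟩ := Function.ne_iff.mp hu0
  simp only [Pi.zero_apply] at hi hj
  have hJ : ∀ r s : ℝ, frameJ h κ p *ᵥ Sum.elim (r • w) (s • w)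
      = Sum.elim ((κ.a₄ (energy h p) * r - κ.a₂ (energy h p) * s) • w)
        ((κ.a₁ (energy h p) * r + κ.a₃ (energy h p) * s) • w) := by
    intro r s
    rw [frameJ, Matrix.fromBlocks_mulVec]
    simp only [Sum.elim_comp_inl, Sum.elim_comp_inr, Matrix.mulVec_smul, Matrix.neg_mulVec,
      endoBlock_mulVec hlw]
    congr 1 <;> module
  have hG : ∀ r s : ℝ, frameG h κ p *ᵥ Sum.elim (r • w) (s • w)
      = Sum.elim ((κ.c₁ (energy h p) * r + κ.c₃ (energy h p) * s) • u)
        ((κ.c₃ (energy h p) * r + κ.c₂ (energy h p) * s) • u) := by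
    intro r s
    rw [frameG, Matrix.fromBlocks_mulVec]
    simp only [Sum.elim_comp_inl, Sum.elim_comp_inr, Matrix.mulVec_smul, formBlock_mulVec hlw, ← hu]
    congr 1 <;> module
  have hJt : ∀ r s : ℝ, (frameJ h κ p)ᵀ *ᵥ Sum.elim (r • u) (s • u)
      = Sum.elim ((κ.a₄ (energy h p) * r + κ.a₁ (energy h p) * s) • u)
        ((-κ.a₂ (energy h p) * r + κ.a₃ (energy h p) * s) • u) := by
    intro r s
    rw [frameJ, Matrix.fromBlocks_transpose, Matrix.fromBlocks_mulVec]
    simp only [Sum.elim_comp_inl, Sum.elim_comp_inr, Matrix.mulVec_smul, Matrix.transpose_neg,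
      Matrix.neg_mulVec, endoBlock_transpose_mulVec hyu]
    congr 1 <;> module
  have hJJ : ∀ v, frameJ h κ p *ᵥ (frameJ h κ p *ᵥ v) = -v := by
    intro v
    rw [Matrix.mulVec_mulVec, hS.frameJ_mul_self hp, Matrix.neg_mulVec, Matrix.one_mulVec]
  have hGJ : ∀ v, frameG h κ p *ᵥ (frameJ h κ p *ᵥ v) = (frameJ h κ p)ᵀ *ᵥ (frameG h κ p *ᵥ v) := by
    intro v
    rw [Matrix.mulVec_mulVec, Matrix.mulVec_mulVec, hS.frameG_mul_frameJ hp]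
  have e1 := hJJ (Sum.elim ((1 : ℝ) • w) ((0 : ℝ) • w))
  have e2 := hJJ (Sum.elim ((0 : ℝ) • w) ((1 : ℝ) • w))
  have e3 := hGJ (Sum.elim ((1 : ℝ) • w) ((0 : ℝ) • w))
  rw [hJ, hJ] at e1 e2
  rw [hJ, hG, hG, hJt] at e3
  have f1 := congrFun e1 (Sum.inl i)
  have f2 := congrFun e1 (Sum.inr i)
  have f3 := congrFun e2 (Sum.inr i)
  have f4 := congrFun e3 (Sum.inr j)
  simp only [Sum.elim_inl, Sum.elim_inr, Pi.smul_apply, Pi.neg_apply, smul_eq_mul] at f1 f2 f3 f4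
  set a₁ := κ.a₁ (energy h p)
  set a₂ := κ.a₂ (energy h p)
  set a₃ := κ.a₃ (energy h p)
  set a₄ := κ.a₄ (energy h p)
  have g1 : a₄ * a₄ - a₂ * a₁ = -1 := mul_right_cancel₀ hi (by linarith)
  have g2 : a₁ * (a₄ + a₃) = 0 := mul_right_cancel₀ hi (by linarith)
  have g3 : -(a₁ * a₂) + a₃ * a₃ = -1 := mul_right_cancel₀ hi (by linarith)
  -- Otherwise a₄² = -1.
  have ha₁ : a₁ ≠ 0 := by
    intro h0
    rw [h0] at g1
    nlinarith [mul_self_nonneg a₄]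
  have h4 : a₄ = -a₃ := by
    have := (mul_eq_zero.mp g2).resolve_left ha₁
    linarith
  have g4 : κ.c₃ (energy h p) * a₄ + κ.c₂ (energy h p) * a₁
      = -a₂ * κ.c₁ (energy h p) + a₃ * κ.c₃ (energy h p) := mul_right_cancel₀ hj (by linarith)
  refine ⟨h4, by linarith, by rw [h4] at g4; linarith, ?_⟩
  exact gram_ne_zero_of_det_ne_zero (hS.isUnit_det_frameG hp) hw (formBlock_mulVec hlw _ _)
    (formBlock_mulVec hlw _ _) (formBlock_mulVec hlw _ _)

theorem coefficient_radial (H : IsLocalMetric h U) (hS : IsLocalStructure κ h U)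
    (hp : base p ∈ U) {t : ℝ} (het : energy h p = t) (ht : 0 < t) :
    (κ.c₁ t + 2 * t * κ.d₁ t) * (κ.c₂ t + 2 * t * κ.d₂ t) - (κ.c₃ t + 2 * t * κ.d₃ t) ^ 2 ≠ 0 := by
  subst het
  have hy : fibre p ≠ 0 := by
    intro h0
    simp [energy_eq, h0] at ht
  exact gram_ne_zero_of_det_ne_zero (hS.isUnit_det_frameG hp) hy (formBlock_mulVec_fibre H _ _)
    (formBlock_mulVec_fibre H _ _) (formBlock_mulVec_fibre H _ _)

/-- The point over `x` in the direction `∂/∂x^i` at energy density `t`. -/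
def pointOfEnergy (h : (Fin n → ℝ) → Matrix (Fin n) (Fin n) ℝ) (x : Fin n → ℝ) (i : Fin n) (t : ℝ) :
    TangentCoord n :=
  Sum.elim x (Pi.single i (√(2 * t / h x i i)))

theorem base_pointOfEnergy (x : Fin n → ℝ) (i : Fin n) (t : ℝ) :
    base (pointOfEnergy h x i t) = x := rfl

theorem fibre_pointOfEnergy (x : Fin n → ℝ) (i : Fin n) (t : ℝ) :
    fibre (pointOfEnergy h x i t) = Pi.single i (√(2 * t / h x i i)) := rfl

theorem energy_pointOfEnergy (H : IsLocalMetric h U) {x : Fin n → ℝ} (hx : x ∈ U) (i : Fin n)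
    {t : ℝ} (ht : 0 ≤ t) : energy h (pointOfEnergy h x i t) = t := by
  have hpos : 0 < h x i i := (H.posDef x hx).diag_pos
  have hs : √(2 * t / h x i i) * √(2 * t / h x i i) = 2 * t / h x i i :=
    Real.mul_self_sqrt (by positivity)
  rw [energy_eq]
  simp only [lowered, fibre_pointOfEnergy, base_pointOfEnergy, Pi.single_apply, ite_mul, zero_mul,
    mul_ite, mul_zero, Finset.sum_ite_eq', Finset.mem_univ, if_true]
  have : √(2 * t / h x i i) * h x i i * √(2 * t / h x i i) = 2 * t := by
    rw [mul_right_comm, hs]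
    field_simp
  rw [this]
  ring

/-- If `Φ = 0` in dimension at least two, the Ricci tensor is a multiple of the metric, with a
factor that depends only on the dimension and on the coefficients. -/
theorem ricci_eq (H : IsLocalMetric h U) (hS : IsLocalStructure κ h U) (hn : 2 ≤ n)
    (hκ : κ.Smooth) (hΦ : ∀ p c, base p ∈ U → formPhi (liftG h κ) (liftJ h κ) c p = 0)
    {t : ℝ} (ht : 0 < t) (I : InverseMetric κ t) {x : Fin n → ℝ} (hx : x ∈ U) (l i : Fin n) :
    ricci h l i x = (deriv κ.a₁ t + 2 * t * deriv κ.b₁ t + (n + 1) * κ.b₁ t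
        + I.volumeCoeff n * (κ.a₁ t + 2 * t * κ.b₁ t)) / κ.a₂ t * h x l i := by
  -- Taking y proportional to ∂/∂x^l isolates the l-th row of the Ricci tensor, because the equation
  -- is linear in y at fixed energy.
  have he := energy_pointOfEnergy H hx l ht.le
  have hp : base (pointOfEnergy h x l t) ∈ U := hx
  have key := ricci_of_formPhi_eq_zero H hS hκ hp he ht (fun c => hΦ _ c hp) I i
  have hpos : 0 < h x l l := (H.posDef x hx).diag_pos
  have hs : √(2 * t / h x l l) ≠ 0 := (Real.sqrt_pos.mpr (by positivity)).ne'
  have ha₂ : κ.a₂ t ≠ 0 := by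
    intro h0
    have := (coefficient_relations H hS hn hp he).2.1
    rw [h0] at this
    nlinarith [sq_nonneg (κ.a₃ t)]
  simp only [lowered, fibre_pointOfEnergy, base_pointOfEnergy, Pi.single_apply, ite_mul, zero_mul,
    Finset.sum_ite_eq', Finset.mem_univ, if_true] at key
  rw [div_mul_eq_mul_div, eq_div_iff ha₂]
  refine mul_left_cancel₀ hs ?_
  linarith

end Pointwise

/-! ### Comparison of two dimensions and elimination of a₂, c₂ and c₂'. -/

section Transverse

variable {κ : Coefficients}

/-- Comparison of the vertical components of `Φ` in two dimensions: the part which is linear in the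
dimension vanishes. -/
theorem transverse_eq_zero {t : ℝ} (I : InverseMetric κ t) {m n : ℕ} (hmn : m ≠ n)
    (hn : deriv κ.a₃ t + 2 * t * deriv κ.b₃ t + (n + 1) * κ.b₃ t
      + I.volumeCoeff n * (κ.a₃ t + 2 * t * κ.b₃ t) - (1 / 2) * I.twistedCoeff n = 0)
    (hm : deriv κ.a₃ t + 2 * t * deriv κ.b₃ t + (m + 1) * κ.b₃ t
      + I.volumeCoeff m * (κ.a₃ t + 2 * t * κ.b₃ t) - (1 / 2) * I.twistedCoeff m = 0) :
    2 * κ.b₃ t + (κ.a₃ t + 2 * t * κ.b₃ t)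
        * (I.α₁ * deriv κ.c₁ t + 2 * I.α₃ * deriv κ.c₃ t + I.α₂ * deriv κ.c₂ t)
      - ((κ.a₄ t * I.α₁ - κ.a₂ t * I.α₃) * deriv κ.c₁ t
        + (κ.a₄ t * I.α₃ - κ.a₂ t * I.α₂ + κ.a₁ t * I.α₁ + κ.a₃ t * I.α₃) * deriv κ.c₃ t
        + (κ.a₁ t * I.α₃ + κ.a₃ t * I.α₂) * deriv κ.c₂ t) = 0 := by
  -- Both equations are values of one affine function of the dimension. Their difference is n - m
  -- times its slope, and the factor 2 clears the halves.
  have hne : (n : ℝ) - m ≠ 0 := sub_ne_zero.mpr (by exact_mod_cast hmn.symm)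
  refine mul_left_cancel₀ hne ?_
  simp only [InverseMetric.volumeCoeff, InverseMetric.twistedCoeff, traceCoeff] at hn hm
  linear_combination 2 * hn - 2 * hm

/-- The equation for `c₃'`, cleared of denominators. -/
theorem c₃_deriv_polynomial {a₁ a₂ a₃ b₃ c₁ c₂ c₃ a₁' a₃' c₁' c₂' c₃' t α₁ α₂ α₃ : ℝ} (ha₁ : a₁ ≠ 0)
    (ha : a₁ * a₂ = 1 + a₃ ^ 2) (hc : a₁ * c₂ = 2 * a₃ * c₃ - a₂ * c₁)
    (hc' : 2 * a₁ * a₁' * c₂ + a₁ ^ 2 * c₂' = 2 * (a₁' * a₃ * c₃ + a₁ * a₃' * c₃ + a₁ * a₃ * c₃')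
      - (c₁' * (1 + a₃ ^ 2) + c₁ * (2 * a₃ * a₃')))
    (h1 : c₁ * α₁ + c₃ * α₃ = 1) (h2 : c₁ * α₃ + c₃ * α₂ = 0) (h3 : c₃ * α₁ + c₂ * α₃ = 0)
    (h4 : c₃ * α₃ + c₂ * α₂ = 1)
    (hB : 2 * b₃ + (a₃ + 2 * t * b₃) * (α₁ * c₁' + 2 * α₃ * c₃' + α₂ * c₂')
      - ((-a₃ * α₁ - a₂ * α₃) * c₁' + (-a₃ * α₃ - a₂ * α₂ + a₁ * α₁ + a₃ * α₃) * c₃'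
        + (a₁ * α₃ + a₃ * α₂) * c₂') = 0) :
    a₁ ^ 2 * (a₁ * c₃ * (a₃ + 2 * b₃ * t) - c₁ * (1 + a₃ ^ 2 + 2 * a₃ * b₃ * t)) * c₃'
      = 2 * a₁' * (1 + a₃ ^ 2) * b₃ * c₁ ^ 2 * t
      - a₁ ^ 2 * c₃ * (c₁' * (1 - a₃ ^ 2) - 2 * a₃' * b₃ * c₁ * t
          + a₃ * (a₃' * c₁ + a₁' * c₃ - 2 * b₃ * (c₁ + c₁' * t))
          - a₁ * c₃ * (a₃' - b₃))
      - c₁ * a₁ * ((1 + a₃ ^ 2) * (b₃ * c₁ + a₃ * c₁' - a₁' * c₃)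
          + 2 * b₃ * (c₁' + a₃ * (a₃' * c₁ + a₃ * c₁' + a₁' * c₃)) * t) := by
  -- Cramer's rule: after multiplication by the Gram determinant, the inverse entries become c₂, c₁
  -- and -c₃.
  have k1 : (c₁ * c₂ - c₃ ^ 2) * α₁ = c₂ := by linear_combination c₂ * h1 - c₃ * h3
  have k2 : (c₁ * c₂ - c₃ ^ 2) * α₂ = c₁ := by linear_combination c₁ * h4 - c₃ * h2
  have k3 : (c₁ * c₂ - c₃ ^ 2) * α₃ = -c₃ := by linear_combination c₁ * h3 - c₃ * h1
  have hB' : 2 * b₃ * (c₁ * c₂ - c₃ ^ 2)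
      + (a₃ + 2 * t * b₃) * (c₂ * c₁' - 2 * c₃ * c₃' + c₁ * c₂')
      - ((-a₃ * c₂ + a₂ * c₃) * c₁' + (-a₂ * c₁ + a₁ * c₂) * c₃'
        + (-a₁ * c₃ + a₃ * c₁) * c₂') = 0 := by
    linear_combination (c₁ * c₂ - c₃ ^ 2) * hB
      - (a₃ + 2 * t * b₃) * (c₁' * k1 + 2 * c₃' * k3 + c₂' * k2)
      + ((-a₃ * k1 - a₂ * k3) * c₁' + (-a₃ * k3 - a₂ * k2 + a₁ * k1 + a₃ * k3) * c₃'
        + (a₁ * k3 + a₃ * k2) * c₂')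
  have e2 : a₂ = (1 + a₃ ^ 2) / a₁ := by rw [eq_div_iff ha₁]; linarith
  have e3 : c₂ = (2 * a₃ * c₃ - a₂ * c₁) / a₁ := by rw [eq_div_iff ha₁]; linarith
  have e4 : c₂' = (2 * (a₁' * a₃ * c₃ + a₁ * a₃' * c₃ + a₁ * a₃ * c₃')
      - (c₁' * (1 + a₃ ^ 2) + c₁ * (2 * a₃ * a₃')) - 2 * a₁ * a₁' * c₂) / a₁ ^ 2 := by
    rw [eq_div_iff (pow_ne_zero 2 ha₁)]; linarith
  subst e4
  subst e3
  subst e2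
  field_simp at hB'
  linear_combination (-1 / 2) * hB'

end Transverse

/-! ### Passage from a Riemannian manifold to its charts. -/

section Manifold

variable {n : ℕ} {M : Type*} [TopologicalSpace M] [ChartedSpace (EuclideanSpace ℝ (Fin n)) M]
  [IsManifold (𝓡 n) ∞ M]

theorem mfderiv_symm_injective {e : OpenPartialHomeomorph M (EuclideanSpace ℝ (Fin n))}
    (he : e ∈ IsManifold.maximalAtlas (𝓡 n) ∞ M) {x : EuclideanSpace ℝ (Fin n)} (hx : x ∈ e.target) :
    Function.Injective (mfderiv (𝓡 n) (𝓡 n) e.symm x) := by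
  have h : e.symm.MDifferentiable (𝓡 n) (𝓡 n) :=
    ⟨(contMDiffOn_symm_of_mem_maximalAtlas he).mdifferentiableOn (by simp),
      (contMDiffOn_of_mem_maximalAtlas he).mdifferentiableOn (by simp)⟩
  exact (h.mfderiv_bijective hx).1

/-- A coordinate vector field is the tangent map of the inverse chart composed with the constant
section v. -/
theorem contMDiffAt_mfderiv_symm {e : OpenPartialHomeomorph M (EuclideanSpace ℝ (Fin n))}
    (he : e ∈ IsManifold.maximalAtlas (𝓡 n) ∞ M) (v x : EuclideanSpace ℝ (Fin n))
    (hx : x ∈ e.target) :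
    ContMDiffAt (𝓡 n) ((𝓡 n).prod 𝓘(ℝ, EuclideanSpace ℝ (Fin n))) ∞ (fun z => (Bundle.TotalSpace.mk' (EuclideanSpace ℝ (Fin n))
      (E := fun y : M => TangentSpace (𝓡 n) y) (e.symm z) (mfderiv (𝓡 n) (𝓡 n) e.symm z v))) x := by
  have h1 := (contMDiffOn_symm_of_mem_maximalAtlas he).contMDiffOn_tangentMapWithin (m := ∞)
    (by simp) e.open_target.uniqueMDiffOn
  have h2 : ContMDiffAt (𝓡 n) (𝓡 n).tangent ∞ (fun z : EuclideanSpace ℝ (Fin n) =>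
      (⟨z, v⟩ : TangentBundle (𝓡 n) (EuclideanSpace ℝ (Fin n)))) x :=
    contMDiffAt_vectorSpace_iff_contDiffAt.mpr contDiffAt_const
  have h3 := (h1 ⟨x, v⟩ hx).comp (s := e.target) x h2.contMDiffWithinAt (fun z hz => hz)
  refine (h3.contMDiffAt (e.open_target.mem_nhds hx)).congr_of_eventuallyEq ?_
  filter_upwards [e.open_target.mem_nhds hx] with z hz
  simp only [Function.comp, tangentMapWithin, mfderivWithin_of_isOpen e.open_target hz]

theorem bilinear_sum_smul {E : Type*} [AddCommGroup E] [Module ℝ E] [TopologicalSpace E]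
    (B : E →L[ℝ] E →L[ℝ] ℝ) (u : Fin n → E) (v : Fin n → ℝ) :
    B (∑ i, v i • u i) (∑ i, v i • u i)
      = star v ⬝ᵥ ((Matrix.of fun i j => B (u i) (u j)) *ᵥ v) := by
  simp only [map_sum, map_smul, _root_.sum_apply, dotProduct, Matrix.mulVec, Matrix.of_apply,
    star_trivial, _root_.smul_apply, smul_eq_mul, Finset.mul_sum]
  rw [Finset.sum_comm]
  exact Finset.sum_congr rfl fun i _ => Finset.sum_congr rfl fun j _ => by ring

/-- Positive definiteness uses that the inverse chart has injective differential on the target.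
Symmetry holds also off the target, because the components are values of a symmetric form even
there. -/
theorem components_isLocalMetric (g : Metric n M)
    {e : OpenPartialHomeomorph M (EuclideanSpace ℝ (Fin n))}
    (he : e ∈ IsManifold.maximalAtlas (𝓡 n) ∞ M) :
    IsLocalMetric (components g e) {x | WithLp.toLp 2 x ∈ e.target} where
  isOpen := e.open_target.preimage (PiLp.continuous_toLp 2 _)
  symm x := by
    ext i j
    exact g.symm _ _ _
  posDef x hx := by
    refine Matrix.PosDef.of_dotProduct_mulVec_pos ?_ ?_
    · ext i j
      simp only [Matrix.conjTranspose_apply, star_trivial]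
      exact g.symm _ _ _
    · intro v hv
      set A := mfderiv (𝓡 n) (𝓡 n) e.symm (WithLp.toLp 2 x) with hA
      have hAv : A (∑ i, v i • EuclideanSpace.single i (1 : ℝ))
          = ∑ i, v i • A (EuclideanSpace.single i (1 : ℝ)) :=
        (map_sum A _ _).trans (Finset.sum_congr rfl fun i _ => map_smul A _ _)
      have hne : A (∑ i, v i • EuclideanSpace.single i (1 : ℝ)) ≠ 0 := by
        intro h0
        have h1 : (∑ i, v i • EuclideanSpace.single i (1 : ℝ) : EuclideanSpace ℝ (Fin n)) = 0 :=
          mfderiv_symm_injective he hx (h0.trans (map_zero A).symm)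
        refine hv (funext fun j => ?_)
        have h2 := congrArg (fun u : EuclideanSpace ℝ (Fin n) => u j) h1
        simpa [Pi.single_apply] using h2
      have hpos := g.pos _ _ hne
      have hval : star v ⬝ᵥ (components g e x *ᵥ v)
          = g.inner (e.symm (WithLp.toLp 2 x)) (∑ i, v i • A (EuclideanSpace.single i (1 : ℝ)))
            (∑ i, v i • A (EuclideanSpace.single i (1 : ℝ))) :=
        (bilinear_sum_smul (g.inner (e.symm (WithLp.toLp 2 x)))
          (fun i => A (EuclideanSpace.single i (1 : ℝ))) v).symm
      rw [hval, ← hAv]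
      exact hpos
  smooth i j x hx := by
    refine ContDiffAt.contDiffWithinAt ?_
    have hv := contMDiffAt_mfderiv_symm he (EuclideanSpace.single i (1 : ℝ)) _ hx
    have hw := contMDiffAt_mfderiv_symm he (EuclideanSpace.single j (1 : ℝ)) _ hx
    have hb : ContMDiffAt (𝓡 n) (𝓡 n) ∞ e.symm (WithLp.toLp 2 x) :=
      contMDiffAt_symm_of_mem_maximalAtlas he hx
    have h1 : ContMDiffAt (𝓡 n) ((𝓡 n).prod 𝓘(ℝ)) ∞ (fun z => Bundle.TotalSpace.mk' ℝ
        (E := Bundle.Trivial M ℝ) (e.symm z) (g.inner (e.symm z)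
          (mfderiv (𝓡 n) (𝓡 n) e.symm z (EuclideanSpace.single i (1 : ℝ)))
          (mfderiv (𝓡 n) (𝓡 n) e.symm z (EuclideanSpace.single j (1 : ℝ))))) (WithLp.toLp 2 x) := by
      apply ContMDiffAt.clm_bundle_apply₂ (F₁ := EuclideanSpace ℝ (Fin n))
        (F₂ := EuclideanSpace ℝ (Fin n))
      · exact ContMDiffAt.comp (WithLp.toLp 2 x) g.contMDiff.contMDiffAt hb
      · exact hv
      · exact hw
    rw [Bundle.contMDiffAt_totalSpace] at h1
    have h2 := h1.2.contDiffAt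
    exact h2.comp x (PiLp.contDiff_toLp (p := 2)).contDiffAt

end Manifold

/-! ### Global consequences: the Einstein property and the formula for c₃'. -/

section SemiAntiKahler

variable {κ : Coefficients}

/-- The algebraic relations between the coefficients on vectors orthogonal to `y`. -/
structure Coefficients.Relations (κ : Coefficients) (t : ℝ) : Prop where
  a₄_eq : κ.a₄ t = -κ.a₃ t
  a₁_mul_a₂ : κ.a₁ t * κ.a₂ t = 1 + κ.a₃ t ^ 2
  a₁_mul_c₂ : κ.a₁ t * κ.c₂ t = 2 * κ.a₃ t * κ.c₃ t - κ.a₂ t * κ.c₁ t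
  gram_ne_zero : κ.c₁ t * κ.c₂ t - κ.c₃ t ^ 2 ≠ 0

theorem Coefficients.Relations.a₁_ne_zero {t : ℝ} (h : κ.Relations t) : κ.a₁ t ≠ 0 := by
  intro h0
  have := h.a₁_mul_a₂
  rw [h0] at this
  nlinarith [sq_nonneg (κ.a₃ t)]

section Manifold

variable {n : ℕ} {M : Type*} [TopologicalSpace M] [ChartedSpace (EuclideanSpace ℝ (Fin n)) M]
  [IsManifold (𝓡 n) ∞ M] {g : Metric n M}

theorem exists_chart_point [Nonempty M] :
    ∃ e ∈ IsManifold.maximalAtlas (𝓡 n) ∞ M, ∃ x : Fin n → ℝ, WithLp.toLp 2 x ∈ e.target := by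
  obtain ⟨q⟩ := ‹Nonempty M›
  refine ⟨chartAt _ q, IsManifold.chart_mem_maximalAtlas q,
    WithLp.ofLp (chartAt (EuclideanSpace ℝ (Fin n)) q q), ?_⟩
  simp

theorem IsAlmostAntiHermitian.isLocalStructure (hg : IsAlmostAntiHermitian κ g)
    {e : OpenPartialHomeomorph M (EuclideanSpace ℝ (Fin n))}
    (he : e ∈ IsManifold.maximalAtlas (𝓡 n) ∞ M) :
    IsLocalStructure κ (components g e) {x | WithLp.toLp 2 x ∈ e.target} :=
  fun p hp => hg e he p hp

/-- The coefficients depend on t only, and every t ≥ 0 is the energy of a tangent vector over any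
single point. -/
theorem IsAlmostAntiHermitian.relations [Nonempty M] (hg : IsAlmostAntiHermitian κ g) (hn : 2 ≤ n)
    {t : ℝ} (ht : 0 ≤ t) : κ.Relations t := by
  obtain ⟨e, he, x, hx⟩ := exists_chart_point (n := n) (M := M)
  have H := components_isLocalMetric g he
  obtain ⟨h1, h2, h3, h4⟩ := coefficient_relations H (hg.isLocalStructure he) hn
    (p := pointOfEnergy _ x ⟨0, by omega⟩ t) hx (energy_pointOfEnergy H hx _ ht)
  exact ⟨h1, h2, h3, h4⟩

theorem IsAlmostAntiHermitian.nonempty_inverseMetric [Nonempty M] (hg : IsAlmostAntiHermitian κ g)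
    (hn : 1 ≤ n) {t : ℝ} (ht : 0 < t) (hκ : κ.Relations t) : Nonempty (InverseMetric κ t) := by
  obtain ⟨e, he, x, hx⟩ := exists_chart_point (n := n) (M := M)
  have H := components_isLocalMetric g he
  exact exists_inverseMetric ht.ne' hκ.gram_ne_zero
    (coefficient_radial H (hg.isLocalStructure he) (p := pointOfEnergy _ x ⟨0, by omega⟩ t) hx
      (energy_pointOfEnergy H hx _ ht.le) ht)

theorem IsSemiAntiKahler.scalar_eq [Nonempty M] (hg : IsSemiAntiKahler κ g) (hs : κ.Smooth)
    (hn : 1 ≤ n) {t : ℝ} (ht : 0 < t) (I : InverseMetric κ t) :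
    deriv κ.a₃ t + 2 * t * deriv κ.b₃ t + (n + 1) * κ.b₃ t
      + I.volumeCoeff n * (κ.a₃ t + 2 * t * κ.b₃ t) - (1 / 2) * I.twistedCoeff n = 0 := by
  obtain ⟨e, he, x, hx⟩ := exists_chart_point (n := n) (M := M)
  have H := components_isLocalMetric g he
  exact scalar_of_formPhi_eq_zero H (hg.1.isLocalStructure he) hs
    (p := pointOfEnergy _ x ⟨0, by omega⟩ t) hx (energy_pointOfEnergy H hx _ ht.le) ht
    (hg.2 e he _ hx) I

theorem IsSemiAntiKahler.isEinstein [Nonempty M] (hg : IsSemiAntiKahler κ g) (hs : κ.Smooth)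
    (hn : 1 ≤ n) : IsEinstein g := by
  -- With one coordinate the curvature vanishes, being antisymmetric in its last two indices.
  obtain rfl | hn2 := hn.eq_or_lt
  · refine ⟨0, fun e _ x _ i j => ?_⟩
    have h0 : ∀ k l a b, curvature (components g e) k l a b x = 0 := by
      intro k l a b
      have := curvature_antisymm (h := components g e) k l a b x
      rw [Subsingleton.elim b a] at this ⊢
      linarith
    simp [ricci, h0]
  -- Any positive energy would do; fixing it once makes ρ the same in all charts and at all points.
  · have ht : (0 : ℝ) < 1 / 2 := by norm_num
    obtain ⟨I⟩ := hg.1.nonempty_inverseMetric hn ht (hg.1.relations hn2 ht.le)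
    exact ⟨_, fun e he x hx i j => ricci_eq (components_isLocalMetric g he)
      (hg.1.isLocalStructure he) hn2 hs (fun p c hp => hg.2 e he p hp c) ht I hx i j⟩

end Manifold

theorem relation_deriv (hs : κ.Smooth) (hκ : ∀ t, 0 ≤ t → κ.Relations t) {t : ℝ} (ht : 0 < t) :
    2 * κ.a₁ t * deriv κ.a₁ t * κ.c₂ t + κ.a₁ t ^ 2 * deriv κ.c₂ t
      = 2 * (deriv κ.a₁ t * κ.a₃ t * κ.c₃ t + κ.a₁ t * deriv κ.a₃ t * κ.c₃ t
          + κ.a₁ t * κ.a₃ t * deriv κ.c₃ t)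
        - (deriv κ.c₁ t * (1 + κ.a₃ t ^ 2) + κ.c₁ t * (2 * κ.a₃ t * deriv κ.a₃ t)) := by
  have d := fun {f : ℝ → ℝ} (hf : ContDiffOn ℝ ∞ f (Set.Ici 0)) =>
    (Coefficients.Smooth.differentiableAt_of_pos hf ht).hasDerivAt
  have h1 := ((d hs.a₁).mul (d hs.a₁)).mul (d hs.c₂)
  have h2 := ((((d hs.a₁).mul (d hs.a₃)).mul (d hs.c₃)).const_mul 2).sub
    ((d hs.c₁).mul (((d hs.a₃).mul (d hs.a₃)).const_add 1))
  -- The relation for c₂ times a₁ is free of a₂, so differentiating it brings in no a₂'.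
  have hev : (κ.a₁ * κ.a₁ * κ.c₂) =ᶠ[nhds t]
      fun s => 2 * (κ.a₁ * κ.a₃ * κ.c₃) s - (κ.c₁ * fun s => 1 + (κ.a₃ * κ.a₃) s) s := by
    filter_upwards [Ioi_mem_nhds ht] with s hs0
    have h := hκ s (le_of_lt hs0)
    simp only [Pi.mul_apply]
    linear_combination κ.a₁ s * h.a₁_mul_c₂ - κ.c₁ s * h.a₁_mul_a₂
  have := h1.unique (h2.congr_of_eventuallyEq hev)
  simp only [Pi.mul_apply] at this
  linear_combination this

theorem c₃Formula_of_scalar_eq (hs : κ.Smooth) (hκ : ∀ t, 0 ≤ t → κ.Relations t) {m n : ℕ}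
    (hmn : m ≠ n) (hI : ∀ t, 0 < t → Nonempty (InverseMetric κ t))
    (hn : ∀ t, 0 < t → ∀ I : InverseMetric κ t,
      deriv κ.a₃ t + 2 * t * deriv κ.b₃ t + (n + 1) * κ.b₃ t
      + I.volumeCoeff n * (κ.a₃ t + 2 * t * κ.b₃ t) - (1 / 2) * I.twistedCoeff n = 0)
    (hm : ∀ t, 0 < t → ∀ I : InverseMetric κ t,
      deriv κ.a₃ t + 2 * t * deriv κ.b₃ t + (m + 1) * κ.b₃ t
      + I.volumeCoeff m * (κ.a₃ t + 2 * t * κ.b₃ t) - (1 / 2) * I.twistedCoeff m = 0)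
    {t : ℝ} (ht : 0 ≤ t) (hden : κ.denom t ≠ 0) : deriv₀ κ.c₃ t = κ.c₃Formula t := by
  -- The cross-multiplied equation is continuous on [0, ∞) even where the denominator vanishes, so
  -- it extends from t > 0 to t = 0 before any division.
  let lhs : ℝ → ℝ := fun t => κ.a₁ t ^ 2 * κ.denom t * deriv₀ κ.c₃ t
  let rhs : ℝ → ℝ := fun t =>
    2 * deriv₀ κ.a₁ t * (1 + κ.a₃ t ^ 2) * κ.b₃ t * κ.c₁ t ^ 2 * t
      - κ.a₁ t ^ 2 * κ.c₃ t * (deriv₀ κ.c₁ t * (1 - κ.a₃ t ^ 2)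
          - 2 * deriv₀ κ.a₃ t * κ.b₃ t * κ.c₁ t * t
          + κ.a₃ t * (deriv₀ κ.a₃ t * κ.c₁ t + deriv₀ κ.a₁ t * κ.c₃ t
            - 2 * κ.b₃ t * (κ.c₁ t + deriv₀ κ.c₁ t * t))
          - κ.a₁ t * κ.c₃ t * (deriv₀ κ.a₃ t - κ.b₃ t))
      - κ.c₁ t * κ.a₁ t * ((1 + κ.a₃ t ^ 2)
            * (κ.b₃ t * κ.c₁ t + κ.a₃ t * deriv₀ κ.c₁ t - deriv₀ κ.a₁ t * κ.c₃ t)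
          + 2 * κ.b₃ t * (deriv₀ κ.c₁ t + κ.a₃ t * (deriv₀ κ.a₃ t * κ.c₁ t
            + κ.a₃ t * deriv₀ κ.c₁ t + deriv₀ κ.a₁ t * κ.c₃ t)) * t)
  have hpos : Set.EqOn lhs rhs (Set.Ioi 0) := by
    intro s hs0
    obtain ⟨I⟩ := hI s hs0
    have hr := hκ s (le_of_lt hs0)
    have hB := transverse_eq_zero I hmn (hn s hs0 I) (hm s hs0 I)
    rw [hr.a₄_eq] at hB
    have hd : ∀ f : ℝ → ℝ, deriv₀ f s = deriv f s := fun f =>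
      derivWithin_of_mem_nhds (Ici_mem_nhds hs0)
    simp only [lhs, rhs, hd, Coefficients.denom]
    exact c₃_deriv_polynomial hr.a₁_ne_zero hr.a₁_mul_a₂ hr.a₁_mul_c₂ (relation_deriv hs hκ hs0)
      I.eq₁ I.eq₂ I.eq₃ I.eq₄ hB
  have c' : ∀ {f : ℝ → ℝ}, ContDiffOn ℝ ∞ f (Set.Ici 0) → ContinuousOn (deriv₀ f) (Set.Ici 0) :=
    fun hf => hf.continuousOn_derivWithin (uniqueDiffOn_Ici 0) (by simp)
  have k1 := hs.a₁.continuousOn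
  have k2 := hs.a₃.continuousOn
  have k3 := hs.b₃.continuousOn
  have k4 := hs.c₁.continuousOn
  have k5 := hs.c₃.continuousOn
  have k6 := c' hs.a₁
  have k7 := c' hs.a₃
  have k8 := c' hs.c₁
  have k9 := c' hs.c₃
  have hl : ContinuousOn lhs (Set.Ici 0) := by
    simp only [lhs, Coefficients.denom]
    fun_prop
  have hr : ContinuousOn rhs (Set.Ici 0) := by
    simp only [rhs]
    fun_prop
  have key : lhs t = rhs t := hpos.of_subset_closure hl hr Set.Ioi_subset_Ici_self
    (closure_Ioi (0 : ℝ)).ge ht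
  have ha₁ := (hκ t ht).a₁_ne_zero
  simp only [lhs, rhs] at key
  simp only [Coefficients.c₃Formula]
  field_simp
  linear_combination key

end SemiAntiKahler

end NaturalLift

end

theorem mainTheorem6
    {κ : NaturalLift.Coefficients} (hκ : κ.Smooth)
    {n : ℕ} (hn : 1 ≤ n)
    {M : Type*} [TopologicalSpace M] [Nonempty M]
    [ChartedSpace (EuclideanSpace ℝ (Fin n)) M] [IsManifold (𝓡 n) ∞ M]
    (g : NaturalLift.Metric n M) (hg : NaturalLift.IsSemiAntiKahler κ g) :
    NaturalLift.IsEinstein g ∧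
    ∀ (m : ℕ) (_ : 1 ≤ m) (_ : m ≠ n)
      (N : Type*) [TopologicalSpace N] [Nonempty N]
      [ChartedSpace (EuclideanSpace ℝ (Fin m)) N] [IsManifold (𝓡 m) ∞ N]
      (g' : NaturalLift.Metric m N) (_ : NaturalLift.IsSemiAntiKahler κ g'),
      ∀ t : ℝ, 0 ≤ t →
        κ.a₁ t * κ.c₃ t * (κ.a₃ t + 2 * κ.b₃ t * t)
          ≠ κ.c₁ t * (1 + κ.a₃ t ^ 2 + 2 * κ.a₃ t * κ.b₃ t * t) →
        NaturalLift.deriv₀ κ.c₃ t = κ.c₃Formula t := by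
  refine ⟨hg.isEinstein hκ hn, ?_⟩
  intro m hm hmn N _ _ _ _ g' hg' t ht hden
  have hrel : ∀ s, 0 ≤ s → κ.Relations s := by
    intro s hs
    -- Two distinct positive dimensions cannot both be 1, so one of the manifolds supplies the
    -- relations.
    by_cases h2 : 2 ≤ n
    · exact hg.1.relations h2 hs
    · exact hg'.1.relations (by omega) hs
  exact NaturalLift.c₃Formula_of_scalar_eq hκ hrel hmn
    (fun s hs => hg.1.nonempty_inverseMetric hn hs (hrel s hs.le))
    (fun s hs I => hg.scalar_eq hκ hn hs I) (fun s hs I => hg'.scalar_eq hκ hm hs I) ht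
    (sub_ne_zero.mpr hden)
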